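/- Let $\mathcal P=\{(-1,1,1),(-1,1,-1),(-1,-1,-1),(1,1,1),(1,1,-1),(1,-1,-1)\}$, let $(q,\theta_1,\theta_2)\in\mathcal P$, and let $m\in\{1,2\}$ be the multiplicative order of $q$. Let $\mathbb C_q$ be the unital associative $\mathbb C$-algebra generated by $t_1^{\pm1},t_2^{\pm1}$ subject to $t_it_i^{-1}=t_i^{-1}t_i=1$ $(i=1,2)$ and $t_2t_1=q\,t_1t_2$, with the $\mathbb C$-linear anti-involution $a\mapsto\bar a$ determined by $\overline{t_1}=\theta_1t_1$, $\overline{t_2}=\theta_2t_2$. Write $R=\mathbb C_q$ and $R_+=\{a\in R:\bar a=a\}$; for subspaces $A,B\subset R$ let $[A,B]$ be the span of all $ab-ba$ with $a\in A$, $b\in B$. Let $n\ge 3$ and $\rho\in\{1,-1\}$. For $a\in R$ and $1\le i,j\le n$ put $$f_{ij}(a)=e_{ij}(a)-e_{n+j,n+i}(\bar a),\quad g_{ij}(a)=e_{i,n+j}(a)-\rho\, e_{j,n+i}(\bar a),\quad h_{ij}(a)=e_{n+i,j}(a)-\rho\, e_{n+j,i}(\bar a),$$ and let $\mathfrak g_{2n,\rho}(\mathbb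 C_q)$ be the Lie subalgebra of $\mathfrak{gl}_{2n}(\mathbb C_q)$ generated by all $f_{ij}(a)$ $(i\ne j)$, $g_{ij}(a)$ and $h_{ij}(a)$ $(i\le j)$, $a\in R$. For a two-sided ideal $J$ of $R$ that is stable under the involution, put $J_+=J\cap R_+$ and $$\Delta(J)=\sum_{i\ne j}f_{ij}(J)+\sum_{i\le j}\bigl(g_{ij}(J)+h_{ij}(J)\bigr),$$ $$\overline{\mathfrak g_{2n,\rho}}(J)=f_{11}\bigl((R_++[R,R])\cap J\bigr)+\sum_{i=2}^n(f_{ii}-f_{11})(J)+\Delta(J),$$ $$\underline{\mathfrak g_{2n,\rho}}(J)=f_{11}\bigl(J_++[J,R]\bigr)+\sum_{i=2}^n(f_{ii}-f_{11})(J)+\Delta(J).$$ For $f,g\in\mathbb C[T]$ with $f(0)g(0)\ne0$ and $\deg f\,\deg g>0$ let $J(f,g)$ be the two-sided ideal of $\mathbb C_q$ generated by $f(t_1^m)$ and $g(t_2^m)$. **Theorem.** Let $\mathcal J$ be an ideal of $\mathfrak g_{2n,\rho}(\mathbb C_q)$ such that $\mathfrak g_{2n,\rho}(\mathbb C_q)/\mathcal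 J$ is finite-dimensional and semisimple (i.e. has zero radical). Then there exist $f,g\in\mathbb C[T]$ with $$f(0)g(0)\neq0,\quad \deg f\,\deg g>0,\quad (f,f')=1,\quad (g,g')=1,\quad f(\theta_1^mT)=f(T),\quad g(\theta_2^mT)=g(T),$$ such that $J(f,g)$ is stable under the involution, $\overline{\mathfrak g_{2n,\rho}}(J(f,g))$ is an ideal of $\mathfrak g_{2n,\rho}(\mathbb C_q)$, and $$\mathcal J\ \supset\ \overline{\mathfrak g_{2n,\rho}}(J(f,g))=\underline{\mathfrak g_{2n,\rho}}(J(f,g)).$$ -/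

import Mathlib

attribute [local instance 100] LieRing.ofAssociativeRing

noncomputable section

namespace BCGraded

/-! ### Algebras with involution, commutators, involutive ideals -/

/-- An involution of an associative unital `k`-algebra `R`: a `k`-linear map `a ↦ ā` of period two
with `(a b)‾ = b‾ a‾`. -/
structure Involution (k R : Type*) [CommRing k] [Ring R] [Algebra k R] where
  toLin : R →ₗ[k] R
  map_mul' : ∀ a b : R, toLin (a * b) = toLin b * toLin a
  invol' : ∀ a : R, toLin (toLin a) = a

section General

variable {k R : Type*} [CommRing k] [Ring R] [Algebra k R]

/-- `R₊ = {a ∈ R | ā = a}`. -/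
def symm (σ : Involution k R) : Submodule k R :=
  LinearMap.ker (σ.toLin - LinearMap.id)

/-- A two-sided ideal, seen as a `k`-subspace. -/
def idealSub (k : Type*) {R : Type*} [CommRing k] [Ring R] [Algebra k R] (J : TwoSidedIdeal R) :
    Submodule k R :=
  (TwoSidedIdeal.asIdeal J).restrictScalars k

/-- `[A, B]`: the `k`-span of all commutators `ab - ba`, `a ∈ A`, `b ∈ B`. -/
def comm (A B : Submodule k R) : Submodule k R :=
  Submodule.span k {x | ∃ a ∈ A, ∃ b ∈ B, x = a * b - b * a}

/-- The two-sided ideal `J` is closed under the involution. -/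
def IsInvolutive (σ : Involution k R) (J : TwoSidedIdeal R) : Prop :=
  ∀ a ∈ J, σ.toLin a ∈ J

/-! ### The Lie algebra `𝔤_{2n,ρ}(R)`

The `2n` row and column indices are `Fin n ⊕ Fin n`: the index `i` is `Sum.inl i`, and the index
`n + i` is `Sum.inr i`. -/

/-- The underlying matrix algebra of `𝔤𝔩_{2n}(R)`. -/
abbrev Mat (n : ℕ) (R : Type*) : Type _ := Matrix (Fin n ⊕ Fin n) (Fin n ⊕ Fin n) R

/-- `f_{ij}(a) = e_{ij}(a) - e_{n+j,n+i}(ā)`. -/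
def fMap (σ : Involution k R) {n : ℕ} (i j : Fin n) : R →ₗ[k] Mat n R :=
  Matrix.singleLinearMap k (Sum.inl i) (Sum.inl j)
    - Matrix.singleLinearMap k (Sum.inr j) (Sum.inr i) ∘ₗ σ.toLin

/-- `g_{ij}(a) = e_{i,n+j}(a) - ρ e_{j,n+i}(ā)`. -/
def gMap (σ : Involution k R) (ρ : ℤˣ) {n : ℕ} (i j : Fin n) : R →ₗ[k] Mat n R :=
  Matrix.singleLinearMap k (Sum.inl i) (Sum.inr j)
    - (ρ : ℤ) • (Matrix.singleLinearMap k (Sum.inl j) (Sum.inr i) ∘ₗ σ.toLin)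

/-- `h_{ij}(a) = e_{n+i,j}(a) - ρ e_{n+j,i}(ā)`. -/
def hMap (σ : Involution k R) (ρ : ℤˣ) {n : ℕ} (i j : Fin n) : R →ₗ[k] Mat n R :=
  Matrix.singleLinearMap k (Sum.inr i) (Sum.inl j)
    - (ρ : ℤ) • (Matrix.singleLinearMap k (Sum.inr j) (Sum.inl i) ∘ₗ σ.toLin)

/-- `𝔤_{2n,ρ}(R)`: the Lie subalgebra of `𝔤𝔩_{2n}(R)` generated by the `f_{ij}(a)` (`i ≠ j`), the
`g_{ij}(a)` (`i ≤ j`) and the `h_{ij}(a)` (`i ≤ j`), `a ∈ R`. -/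
def gLie (n : ℕ) (ρ : ℤˣ) (σ : Involution k R) : LieSubalgebra k (Mat n R) :=
  LieSubalgebra.lieSpan k (Mat n R)
    ({x | ∃ (i j : Fin n) (a : R), i ≠ j ∧ x = fMap σ i j a} ∪
     {x | ∃ (i j : Fin n) (a : R), i ≤ j ∧ x = gMap σ ρ i j a} ∪
     {x | ∃ (i j : Fin n) (a : R), i ≤ j ∧ x = hMap σ ρ i j a})

/-- `Δ(J) = ∑_{i ≠ j} f_{ij}(J) + ∑_{i ≤ j} (g_{ij}(J) + h_{ij}(J))`. -/
def deltaSub (n : ℕ) (ρ : ℤˣ) (σ : Involution k R) (J : TwoSidedIdeal R) :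
    Submodule k (Mat n R) :=
  (⨆ (i : Fin n) (j : Fin n) (_ : i ≠ j), (idealSub k J).map (fMap σ i j)) ⊔
  (⨆ (i : Fin n) (j : Fin n) (_ : i ≤ j),
    (idealSub k J).map (gMap σ ρ i j) ⊔ (idealSub k J).map (hMap σ ρ i j))

/-- `∑_{i = 2}^{n} (f_{ii} - f_{11})(J)`; the first index is `0 : Fin n`. -/
def diagSub (n : ℕ) [NeZero n] (σ : Involution k R) (J : TwoSidedIdeal R) :
    Submodule k (Mat n R) :=
  ⨆ (i : Fin n) (_ : i ≠ 0), (idealSub k J).map (fMap σ i i - fMap σ 0 0)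

/-- The overlined subspace:
`f_{11}((R₊ + [R,R]) ∩ J) + ∑_{i = 2}^{n} (f_{ii} - f_{11})(J) + Δ(J)`. -/
def overG (n : ℕ) [NeZero n] (ρ : ℤˣ) (σ : Involution k R) (J : TwoSidedIdeal R) :
    Submodule k (Mat n R) :=
  ((symm σ ⊔ comm ⊤ ⊤) ⊓ idealSub k J).map (fMap σ (0 : Fin n) 0)
    ⊔ diagSub n σ J ⊔ deltaSub n ρ σ J

/-- The underlined subspace:
`f_{11}(J₊ + [J,R]) + ∑_{i = 2}^{n} (f_{ii} - f_{11})(J) + Δ(J)`, with `J₊ = J ∩ R₊`. -/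
def underG (n : ℕ) [NeZero n] (ρ : ℤˣ) (σ : Involution k R) (J : TwoSidedIdeal R) :
    Submodule k (Mat n R) :=
  ((symm σ ⊓ idealSub k J) ⊔ comm (idealSub k J) ⊤).map (fMap σ (0 : Fin n) 0)
    ⊔ diagSub n σ J ⊔ deltaSub n ρ σ J

end General

/-! ### The elementary quantum torus -/

/-- Names of the generators `t₁, t₁⁻¹, t₂, t₂⁻¹`. -/
inductive TorusGen
  | t1 | t1inv | t2 | t2inv

/-- The defining relations `t₁t₁⁻¹ = t₁⁻¹t₁ = t₂t₂⁻¹ = t₂⁻¹t₂ = 1` and `t₂t₁ = q t₁t₂`. -/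
inductive TorusRel (q : ℂ) : FreeAlgebra ℂ TorusGen → FreeAlgebra ℂ TorusGen → Prop
  | mul_inv1 : TorusRel q (FreeAlgebra.ι ℂ .t1 * FreeAlgebra.ι ℂ .t1inv) 1
  | inv_mul1 : TorusRel q (FreeAlgebra.ι ℂ .t1inv * FreeAlgebra.ι ℂ .t1) 1
  | mul_inv2 : TorusRel q (FreeAlgebra.ι ℂ .t2 * FreeAlgebra.ι ℂ .t2inv) 1
  | inv_mul2 : TorusRel q (FreeAlgebra.ι ℂ .t2inv * FreeAlgebra.ι ℂ .t2) 1
  | twist : TorusRel q (FreeAlgebra.ι ℂ .t2 * FreeAlgebra.ι ℂ .t1)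
      (algebraMap ℂ _ q * (FreeAlgebra.ι ℂ .t1 * FreeAlgebra.ι ℂ .t2))

/-- The quantum torus `ℂ_q = ℂ_q[t₁^{±1}, t₂^{±1}]`. -/
def QTorus (q : ℂ) : Type := RingQuot (TorusRel q)

instance (q : ℂ) : Ring (QTorus q) := inferInstanceAs (Ring (RingQuot (TorusRel q)))

instance (q : ℂ) : Algebra ℂ (QTorus q) := inferInstanceAs (Algebra ℂ (RingQuot (TorusRel q)))

/-- The image of a generator in `ℂ_q`. -/
def tgen (q : ℂ) (x : TorusGen) : QTorus q :=
  RingQuot.mkAlgHom ℂ (TorusRel q) (FreeAlgebra.ι ℂ x)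

/-- A sign as a complex number. -/
def sgn (ε : ℤˣ) : ℂ := ((ε : ℤ) : ℂ)

theorem sgn_mul_self (ε : ℤˣ) : sgn ε * sgn ε = 1 := by
  rcases Int.units_eq_one_or ε with rfl | rfl <;> simp [sgn]

/-- The sign by which the involution acts on a generator. -/
def genSign (θ₁ θ₂ : ℤˣ) : TorusGen → ℤˣ
  | .t1 => θ₁
  | .t1inv => θ₁
  | .t2 => θ₂
  | .t2inv => θ₂

theorem tgen_mul_inv1 (q : ℂ) : tgen q .t1 * tgen q .t1inv = 1 := by
  have h := RingQuot.mkAlgHom_rel ℂ (TorusRel.mul_inv1 (q := q))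
  rw [map_mul, map_one] at h
  exact h

theorem tgen_inv_mul1 (q : ℂ) : tgen q .t1inv * tgen q .t1 = 1 := by
  have h := RingQuot.mkAlgHom_rel ℂ (TorusRel.inv_mul1 (q := q))
  rw [map_mul, map_one] at h
  exact h

theorem tgen_mul_inv2 (q : ℂ) : tgen q .t2 * tgen q .t2inv = 1 := by
  have h := RingQuot.mkAlgHom_rel ℂ (TorusRel.mul_inv2 (q := q))
  rw [map_mul, map_one] at h
  exact h

theorem tgen_inv_mul2 (q : ℂ) : tgen q .t2inv * tgen q .t2 = 1 := by
  have h := RingQuot.mkAlgHom_rel ℂ (TorusRel.inv_mul2 (q := q))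
  rw [map_mul, map_one] at h
  exact h

theorem tgen_twist (q : ℂ) : tgen q .t2 * tgen q .t1 = q • (tgen q .t1 * tgen q .t2) := by
  have h := RingQuot.mkAlgHom_rel ℂ (TorusRel.twist (q := q))
  rw [map_mul, map_mul, map_mul, AlgHom.commutes, ← Algebra.smul_def] at h
  exact h

/-- The algebra homomorphism `ℂ_q → ℂ_q^op` with `t₁ ↦ θ₁ t₁`, `t₂ ↦ θ₂ t₂` (so
`tᵢ⁻¹ ↦ θᵢ tᵢ⁻¹`), for signs `q, θ₁, θ₂`. -/
def barHom (q θ₁ θ₂ : ℤˣ) : QTorus (sgn q) →ₐ[ℂ] (QTorus (sgn q))ᵐᵒᵖ :=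
  RingQuot.liftAlgHom ℂ (s := TorusRel (sgn q))
    ⟨FreeAlgebra.lift ℂ
      (fun x => MulOpposite.op (sgn (genSign θ₁ θ₂ x) • tgen (sgn q) x)), by
      intro x y h
      cases h
      case twist =>
        simp only [map_mul, FreeAlgebra.lift_ι_apply, AlgHom.commutes, genSign]
        rw [← Algebra.smul_def, ← MulOpposite.op_mul, ← MulOpposite.op_mul,
          ← MulOpposite.op_smul]
        congr 1
        simp only [smul_mul_smul_comm, tgen_twist, smul_smul]
        congr 1
        linear_combination (-(sgn θ₁ * sgn θ₂)) * sgn_mul_self q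
      all_goals
        simp only [map_mul, map_one, FreeAlgebra.lift_ι_apply, genSign]
        rw [← MulOpposite.op_mul, smul_mul_smul_comm, sgn_mul_self, one_smul]
        simp [tgen_mul_inv1, tgen_inv_mul1, tgen_mul_inv2, tgen_inv_mul2]⟩

theorem barHom_tgen (q θ₁ θ₂ : ℤˣ) (x : TorusGen) :
    barHom q θ₁ θ₂ (tgen (sgn q) x)
      = MulOpposite.op (sgn (genSign θ₁ θ₂ x) • tgen (sgn q) x) := by
  unfold barHom tgen
  erw [RingQuot.liftAlgHom_mkAlgHom_apply]
  exact FreeAlgebra.lift_ι_apply _ _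

theorem barHom_invol (q θ₁ θ₂ : ℤˣ) (a : QTorus (sgn q)) :
    (barHom q θ₁ θ₂ (barHom q θ₁ θ₂ a).unop).unop = a := by
  obtain ⟨b, rfl⟩ := RingQuot.mkAlgHom_surjective ℂ (TorusRel (sgn q)) a
  induction b using FreeAlgebra.induction with
  | grade0 r =>
    have h : (RingQuot.mkAlgHom ℂ (TorusRel (sgn q)) (algebraMap ℂ _ r) : QTorus (sgn q))
        = algebraMap ℂ (QTorus (sgn q)) r := AlgHom.commutes _ r
    rw [h, AlgHom.commutes, MulOpposite.algebraMap_apply, MulOpposite.unop_op, AlgHom.commutes,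
      MulOpposite.algebraMap_apply, MulOpposite.unop_op]
  | grade1 x =>
    change (barHom q θ₁ θ₂ (barHom q θ₁ θ₂ (tgen (sgn q) x)).unop).unop = tgen (sgn q) x
    rw [barHom_tgen, MulOpposite.unop_op, map_smul, barHom_tgen, ← MulOpposite.op_smul,
      MulOpposite.unop_op, smul_smul, sgn_mul_self, one_smul]
  | mul a b ha hb =>
    rw [map_mul]
    erw [map_mul, MulOpposite.unop_mul, map_mul, MulOpposite.unop_mul]
    exact congrArg₂ (· * ·) ha hb
  | add a b ha hb =>
    rw [map_add]
    erw [map_add, MulOpposite.unop_add, map_add, MulOpposite.unop_add]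
    exact congrArg₂ (· + ·) ha hb

/-- The involution of the elementary quantum torus `ℂ_q` (`q = ±1`) that is determined by
`t₁‾ = θ₁ t₁`, `t₂‾ = θ₂ t₂` (`θᵢ = ±1`). -/
def torusBar (q θ₁ θ₂ : ℤˣ) : Involution ℂ (QTorus (sgn q)) where
  toLin := (MulOpposite.opLinearEquiv ℂ).symm.toLinearMap ∘ₗ (barHom q θ₁ θ₂).toLinearMap
  map_mul' a b := by simp
  invol' a := barHom_invol q θ₁ θ₂ a

/-- The set `𝒫` of the six parameter triples `(q, θ₁, θ₂)`. -/
def paramSet : Set (ℤˣ × ℤˣ × ℤˣ) :=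
  {(-1, 1, 1), (-1, 1, -1), (-1, -1, -1), (1, 1, 1), (1, 1, -1), (1, -1, -1)}

/-- `J(f, g)`: the two-sided ideal of `ℂ_q` generated by `f(t₁ᵐ)` and `g(t₂ᵐ)`, where `m` is the
multiplicative order of `q`. -/
def idealJ (q : ℤˣ) (f g : Polynomial ℂ) : TwoSidedIdeal (QTorus (sgn q)) :=
  TwoSidedIdeal.span
    {Polynomial.aeval (tgen (sgn q) .t1 ^ orderOf q) f,
     Polynomial.aeval (tgen (sgn q) .t2 ^ orderOf q) g}

end BCGraded

end

/-! The ideal `𝒥` is controlled by its coefficient ideal `coeffIdeal`, the set of `a` with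
`f_{ij}(a) ∈ 𝒥` for all `i ≠ j`. As `n ≥ 3`, brackets through a third index make it two-sided and
involutive, and further brackets put its `underG` inside `𝒥` (`underG_le`). It therefore suffices to
find suitable `f`, `g` with `f(t₁ᵐ)` and `g(t₂ᵐ)` in the coefficient ideal.

Finite dimension of the quotient gives `p ≠ 0` with `p(t₁²)` in the coefficient ideal. Since `t₁²`
is invertible, some power of a squarefree polynomial in `t₁²` with nonzero constant term lies there
too. Semisimplicity removes the power, because `t₁²` is central and fixed by the involution: if `z`
is central and fixed and `z²` is a coefficient, the skew matrices with entries in `z²R`, and then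
those with entries in `zR`, form ideals abelian modulo `𝒥`, hence contained in `𝒥`
(`mem_coeffIdeal_of_mul_self_mem`). The same works for `t₂`.

Both this step and the ideal property of `underG` rest on `lie_mem_underG`: a skew matrix with
entries in `J` lies in `underG` as soon as the trace of its upper left block lies in `J₊ + [J,R]`,
and brackets satisfy this trace condition.

Finally `overG = underG` for every two-sided ideal `J` of the torus. For `q = 1` commutators vanish;
for `q = -1` conjugation by `t₁` and `t₂` shows `J ⊆ J₊ + [J,R]`. -/

noncomputable section

namespace BCGraded

open Matrix

/-! ### Bracket relations between root vectors -/

section Brackets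

variable {k R : Type*} [CommRing k] [Ring R] [Algebra k R]

theorem Involution.map_one (σ : Involution k R) : σ.toLin 1 = 1 := by
  have h := σ.map_mul' 1 (σ.toLin 1)
  rw [one_mul, σ.invol', one_mul] at h
  exact h.symm

theorem mem_symm {σ : Involution k R} {a : R} : a ∈ symm σ ↔ σ.toLin a = a := by
  simp [symm, sub_eq_zero]

theorem units_smul_smul {M : Type*} [AddCommGroup M] (ρ : ℤˣ) (x : M) :
    (ρ : ℤ) • (ρ : ℤ) • x = x := by
  rcases Int.units_eq_one_or ρ with rfl | rfl <;> simp

variable (σ : Involution k R) (ρ : ℤˣ) {n : ℕ}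

theorem fMap_apply (i j : Fin n) (a : R) :
    fMap σ i j a = single (Sum.inl i) (Sum.inl j) a
      - single (Sum.inr j) (Sum.inr i) (σ.toLin a) := rfl

theorem gMap_apply (i j : Fin n) (a : R) :
    gMap σ ρ i j a = single (Sum.inl i) (Sum.inr j) a
      - (ρ : ℤ) • single (Sum.inl j) (Sum.inr i) (σ.toLin a) := rfl

theorem hMap_apply (i j : Fin n) (a : R) :
    hMap σ ρ i j a = single (Sum.inr i) (Sum.inl j) a
      - (ρ : ℤ) • single (Sum.inr j) (Sum.inl i) (σ.toLin a) := rfl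

theorem gMap_swap (i j : Fin n) (a : R) :
    gMap σ ρ i j a = -((ρ : ℤ) • gMap σ ρ j i (σ.toLin a)) := by
  simp only [gMap_apply, smul_sub, units_smul_smul, σ.invol', neg_sub]

theorem hMap_swap (i j : Fin n) (a : R) :
    hMap σ ρ i j a = -((ρ : ℤ) • hMap σ ρ j i (σ.toLin a)) := by
  simp only [hMap_apply, smul_sub, units_smul_smul, σ.invol', neg_sub]

variable {i j l : Fin n}

theorem single_mul_single_eq_ite (p q r s : Fin n ⊕ Fin n) (a b : R) :
    single p q a * single r s b = if q = r then single p s (a * b) else 0 := by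
  split_ifs with h
  · subst h; exact single_mul_single_same ..
  · exact single_mul_single_of_ne _ _ _ _ h _

theorem lie_fMap_fMap (hil : i ≠ l) (a b : R) :
    ⁅fMap σ i j a, fMap σ j l b⁆ = fMap σ i l (a * b) := by
  simp only [Ring.lie_def, fMap_apply, mul_sub, sub_mul, single_mul_single_eq_ite, σ.map_mul',
    hil, hil.symm, Sum.inl.injEq, Sum.inr.injEq, reduceCtorEq, if_true, if_false]
  abel

theorem lie_fMap_fMap_swap (a b : R) :
    ⁅fMap σ i j a, fMap σ j i b⁆ = fMap σ i i (a * b) - fMap σ j j (b * a) := by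
  simp only [Ring.lie_def, fMap_apply, mul_sub, sub_mul, single_mul_single_eq_ite, σ.map_mul',
    reduceCtorEq, if_true, if_false]
  abel

theorem lie_fMap_gMap (hjl : j ≠ l) (a b : R) :
    ⁅fMap σ i j a, gMap σ ρ j l b⁆ = gMap σ ρ i l (a * b) := by
  simp only [Ring.lie_def, fMap_apply, gMap_apply, mul_sub, sub_mul, single_mul_single_eq_ite,
    σ.map_mul', hjl, hjl.symm, smul_mul_assoc, mul_smul_comm,
    Sum.inl.injEq, Sum.inr.injEq, reduceCtorEq, if_true, if_false, smul_zero,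
    zero_sub, sub_zero]
  abel

theorem lie_hMap_fMap (hjl : j ≠ l) (a b : R) :
    ⁅hMap σ ρ l j b, fMap σ j i a⁆ = hMap σ ρ l i (b * a) := by
  simp only [Ring.lie_def, fMap_apply, hMap_apply, mul_sub, sub_mul, single_mul_single_eq_ite,
    σ.map_mul', hjl, hjl.symm, smul_mul_assoc, mul_smul_comm,
    Sum.inl.injEq, Sum.inr.injEq, reduceCtorEq, if_true, if_false, smul_zero,
    zero_sub, sub_zero, smul_neg]
  abel

theorem lie_gMap_hMap (hij : i ≠ j) (hjl : j ≠ l) (hil : i ≠ l) (a b : R) :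
    ⁅gMap σ ρ i j a, hMap σ ρ j l b⁆ = fMap σ i l (a * b) := by
  simp only [Ring.lie_def, fMap_apply, gMap_apply, hMap_apply, mul_sub, sub_mul,
    single_mul_single_eq_ite, σ.map_mul', hij, hij.symm, hjl, hjl.symm, hil, hil.symm,
    smul_mul_assoc, mul_smul_comm,
    Sum.inl.injEq, Sum.inr.injEq, if_true, if_false, smul_zero,
    zero_sub, sub_zero, smul_neg, units_smul_smul]
  abel

theorem lie_gMap_hMap_swap (hij : i ≠ j) (a b : R) :
    ⁅gMap σ ρ i j a, hMap σ ρ j i b⁆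
      = fMap σ i i (a * b) + fMap σ j j (σ.toLin a * σ.toLin b) := by
  simp only [Ring.lie_def, fMap_apply, gMap_apply, hMap_apply, mul_sub, sub_mul,
    single_mul_single_eq_ite, σ.map_mul', hij, hij.symm, σ.invol',
    smul_mul_assoc, mul_smul_comm,
    Sum.inl.injEq, Sum.inr.injEq, if_true, if_false, smul_zero,
    zero_sub, sub_zero, smul_neg, units_smul_smul]
  abel

theorem fMap_mem_gLie (hij : i ≠ j) (a : R) : fMap σ i j a ∈ gLie n ρ σ :=
  LieSubalgebra.subset_lieSpan (.inl (.inl ⟨i, j, a, hij, rfl⟩))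

theorem gMap_mem_gLie (i j : Fin n) (a : R) : gMap σ ρ i j a ∈ gLie n ρ σ := by
  rcases le_total i j with h | h
  · exact LieSubalgebra.subset_lieSpan (.inl (.inr ⟨i, j, a, h, rfl⟩))
  · rw [gMap_swap]
    exact neg_mem (zsmul_mem (LieSubalgebra.subset_lieSpan (.inl (.inr ⟨j, i, _, h, rfl⟩))) _)

theorem hMap_mem_gLie (i j : Fin n) (a : R) : hMap σ ρ i j a ∈ gLie n ρ σ := by
  rcases le_total i j with h | h
  · exact LieSubalgebra.subset_lieSpan (.inr ⟨i, j, a, h, rfl⟩)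
  · rw [hMap_swap]
    exact neg_mem (zsmul_mem (LieSubalgebra.subset_lieSpan (.inr ⟨j, i, _, h, rfl⟩)) _)

end Brackets

/-- The sole source of `n ≥ 3`: bracketing through a third index multiplies coefficients without
producing diagonal terms. -/
theorem exists_ne_ne {n : ℕ} (hn : 3 ≤ n) (i j : Fin n) : ∃ l : Fin n, l ≠ i ∧ l ≠ j := by
  have h : ({i, j} : Finset (Fin n)).card < Fintype.card (Fin n) :=
    (Finset.card_le_two).trans_lt (by simp; omega)
  obtain ⟨l, hl⟩ := Finset.exists_mem_notMem_of_card_lt_card h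
  exact ⟨l, by simpa using hl.2⟩

/-! ### Root spaces in a subspace stable under `𝔤_{2n,ρ}(R)` -/

section Stable

variable {k R : Type*} [CommRing k] [Ring R] [Algebra k R] {σ : Involution k R} {ρ : ℤˣ} {n : ℕ}
  {P : Submodule k (Mat n R)}

/-- The coefficients of the `f_{ij}`, `i ≠ j`, that lie in a subspace stable under
`𝔤_{2n,ρ}(R)`. -/
def coeffIdeal (hn : 3 ≤ n) (hP : ∀ x ∈ gLie n ρ σ, ∀ y ∈ P, ⁅x, y⁆ ∈ P) : TwoSidedIdeal R :=
  TwoSidedIdeal.mk' {a | ∀ i j : Fin n, i ≠ j → fMap σ i j a ∈ P}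
    (fun i j _ => by simp)
    (fun ha hb i j h => by rw [map_add]; exact add_mem (ha i j h) (hb i j h))
    (fun ha i j h => by rw [map_neg]; exact neg_mem (ha i j h))
    (fun {x y} hy i j h => by
      obtain ⟨l, hi, hj⟩ := exists_ne_ne hn i j
      rw [← lie_fMap_fMap σ (j := l) h]
      exact hP _ (fMap_mem_gLie σ ρ hi.symm x) _ (hy l j hj))
    (fun {x y} hx i j h => by
      obtain ⟨l, hi, hj⟩ := exists_ne_ne hn i j
      rw [← lie_fMap_fMap σ (j := l) h, ← lie_skew]
      exact neg_mem (hP _ (fMap_mem_gLie σ ρ hj y) _ (hx i l hi.symm)))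

variable (hP : ∀ x ∈ gLie n ρ σ, ∀ y ∈ P, ⁅x, y⁆ ∈ P)
include hP

theorem mem_coeffIdeal (hn : 3 ≤ n) {a : R} :
    a ∈ coeffIdeal hn hP ↔ ∀ i j : Fin n, i ≠ j → fMap σ i j a ∈ P :=
  TwoSidedIdeal.mem_mk' _ _ _ _ _ _ _

theorem lie_mem_of_left {x y : Mat n R} (hx : x ∈ P) (hy : y ∈ gLie n ρ σ) : ⁅x, y⁆ ∈ P := by
  rw [← lie_skew]
  exact neg_mem (hP y hy x hx)

theorem gMap_mem_of_fMap_mem (hn : 3 ≤ n) {a : R}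
    (ha : ∀ i j : Fin n, i ≠ j → fMap σ i j a ∈ P) (i j : Fin n) : gMap σ ρ i j a ∈ P := by
  obtain ⟨l, hi, hj⟩ := exists_ne_ne hn i j
  rw [← mul_one a, ← lie_fMap_gMap σ ρ hj]
  exact lie_mem_of_left hP (ha i l hi.symm) (gMap_mem_gLie σ ρ l j 1)

theorem hMap_mem_of_fMap_mem (hn : 3 ≤ n) {a : R}
    (ha : ∀ i j : Fin n, i ≠ j → fMap σ i j a ∈ P) (i j : Fin n) : hMap σ ρ i j a ∈ P := by
  obtain ⟨l, hi, hj⟩ := exists_ne_ne hn i j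
  rw [← one_mul a, ← lie_hMap_fMap σ ρ hi]
  exact hP _ (hMap_mem_gLie σ ρ i l 1) _ (ha l j hj)

/-- Exchanging the two indices of `g` applies the involution to its coefficient, and `[g_{il}(ā),
h_{lj}(1)] = f_{ij}(ā)` returns to the `f`'s. -/
theorem isInvolutive_coeffIdeal (hn : 3 ≤ n) : IsInvolutive σ (coeffIdeal hn hP) := by
  intro a ha
  rw [mem_coeffIdeal] at ha ⊢
  intro i j hij
  obtain ⟨l, hi, hj⟩ := exists_ne_ne hn i j
  rw [← mul_one (σ.toLin a), ← lie_gMap_hMap σ ρ hi.symm hj hij]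
  refine lie_mem_of_left hP ?_ (hMap_mem_gLie σ ρ l j 1)
  rw [gMap_swap, σ.invol']
  exact neg_mem (zsmul_mem (gMap_mem_of_fMap_mem hP hn ha l i) _)

theorem fMap_sub_fMap_mem {a : R} (ha : ∀ i j : Fin n, i ≠ j → fMap σ i j a ∈ P) {i j : Fin n}
    (hij : i ≠ j) : fMap σ i i a - fMap σ j j a ∈ P := by
  have h := lie_mem_of_left hP (ha i j hij) (fMap_mem_gLie σ ρ hij.symm 1)
  rwa [lie_fMap_fMap_swap σ, mul_one, one_mul] at h

end Stable

section UnderG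

variable {k R : Type*} [Field k] [NeZero (2 : k)] [Ring R] [Algebra k R] {σ : Involution k R}
  {ρ : ℤˣ} {n : ℕ} {P : Submodule k (Mat n R)}

theorem underG_le [NeZero n] (hn : 3 ≤ n) (hP : ∀ x ∈ gLie n ρ σ, ∀ y ∈ P, ⁅x, y⁆ ∈ P)
    {J : TwoSidedIdeal R} (hJ : ∀ a ∈ J, ∀ i j : Fin n, i ≠ j → fMap σ i j a ∈ P) :
    underG n ρ σ J ≤ P := by
  obtain ⟨l, hl, -⟩ := exists_ne_ne hn (0 : Fin n) 0
  refine sup_le (sup_le ?_ ?_) (sup_le ?_ ?_)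
  · rw [Submodule.map_le_iff_le_comap]
    refine sup_le ?_ (Submodule.span_le.2 ?_)
    · rintro a ⟨ha, haJ⟩
      replace haJ : a ∈ J := haJ
      replace ha : σ.toLin a = a := mem_symm.1 ha
      -- For `ā = a` this bracket is `f₀₀(a) + f_{ll}(a)`; adding `f₀₀(a) - f_{ll}(a)` leaves `2
      -- f₀₀(a)`.
      have h1 := lie_mem_of_left hP (gMap_mem_of_fMap_mem hP hn (hJ a haJ) 0 l)
        (hMap_mem_gLie σ ρ l 0 1)
      rw [lie_gMap_hMap_swap σ ρ hl.symm, mul_one, σ.map_one, mul_one, ha] at h1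
      have h2 := add_mem h1 (fMap_sub_fMap_mem hP (hJ a haJ) hl.symm)
      rw [add_add_sub_cancel, ← two_smul k] at h2
      exact (P.smul_mem_iff two_ne_zero).1 h2
    · rintro _ ⟨a, ha, b, -, rfl⟩
      replace ha : a ∈ J := ha
      -- The bracket is `f₀₀(ab) - f_{ll}(ba)`; subtracting `f₀₀(ba) - f_{ll}(ba)` leaves `f₀₀(ab -
      -- ba)`.
      have h1 := lie_mem_of_left hP (hJ a ha 0 l hl.symm) (fMap_mem_gLie σ ρ hl b)
      rw [lie_fMap_fMap_swap σ] at h1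
      have h2 := sub_mem h1 (fMap_sub_fMap_mem hP (hJ _ (J.mul_mem_left b a ha)) hl.symm)
      rw [sub_sub_sub_cancel_right, ← map_sub] at h2
      exact h2
  · refine iSup₂_le fun i hi => ?_
    rintro _ ⟨a, ha, rfl⟩
    exact fMap_sub_fMap_mem hP (hJ a ha) hi
  · refine iSup₂_le fun i j => iSup_le fun hij => ?_
    rintro _ ⟨a, ha, rfl⟩
    exact hJ a ha i j hij
  · refine iSup₂_le fun i j => iSup_le fun _ => sup_le ?_ ?_
    · rintro _ ⟨a, ha, rfl⟩
      exact gMap_mem_of_fMap_mem hP hn (hJ a ha) i j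
    · rintro _ ⟨a, ha, rfl⟩
      exact hMap_mem_of_fMap_mem hP hn (hJ a ha) i j

end UnderG

/-! ### Matrices that are skew for the involution defining `𝔤_{2n,ρ}(R)` -/

section Skew

variable {k R : Type*} [CommRing k] [Ring R] [Algebra k R] (σ : Involution k R) (ρ : ℤˣ) {n : ℕ}

/-- The sign attached to an index of a `2n × 2n` matrix. -/
def indexSign : Fin n ⊕ Fin n → ℤˣ := Sum.elim (fun _ => 1) (fun _ => ρ)

/-- The skew matrices with entries in `A`. -/
def skewSub (n : ℕ) (A : Submodule k R) : Submodule k (Mat n R) where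
  carrier := {X | ∀ p q, X p q ∈ A ∧
    σ.toLin (X q.swap p.swap) = -(((indexSign ρ p * indexSign ρ q : ℤˣ) : ℤ) • X p q)}
  zero_mem' p q := by simp
  add_mem' hX hY p q := by
    refine ⟨add_mem (hX p q).1 (hY p q).1, ?_⟩
    rw [Matrix.add_apply, map_add, (hX p q).2, (hY p q).2, Matrix.add_apply, smul_add, neg_add]
  smul_mem' c X hX p q := by
    refine ⟨A.smul_mem c (hX p q).1, ?_⟩
    rw [Matrix.smul_apply, map_smul, (hX p q).2, Matrix.smul_apply, smul_neg, smul_comm]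

variable {σ ρ} {A B C : Submodule k R} {X Y : Mat n R}

theorem skewSub_mono (h : A ≤ B) : skewSub σ ρ n A ≤ skewSub σ ρ n B :=
  fun _ hX p q => ⟨h (hX p q).1, (hX p q).2⟩

/-- The signed adjoint reverses products. The two minus signs of skewness cancel, and the sign of
the summation index occurs squared. -/
theorem apply_mul_of_mem_skewSub (hX : X ∈ skewSub σ ρ n A) (hY : Y ∈ skewSub σ ρ n B)
    (p q : Fin n ⊕ Fin n) :
    σ.toLin ((X * Y) q.swap p.swap)
      = ((indexSign ρ p * indexSign ρ q : ℤˣ) : ℤ) • (Y * X) p q := by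
  simp only [Matrix.mul_apply, map_sum, σ.map_mul', Finset.smul_sum]
  refine Fintype.sum_equiv (Equiv.sumComm _ _) _ _ fun r => ?_
  obtain ⟨r, rfl⟩ : ∃ s : Fin n ⊕ Fin n, s.swap = r := ⟨r.swap, r.swap_swap⟩
  rw [(hX r q).2, (hY p r).2, Equiv.sumComm_apply, Sum.swap_swap, neg_mul_neg, smul_mul_smul_comm,
    ← Units.val_mul]
  congr 2
  rw [mul_assoc, ← mul_assoc (indexSign ρ r), Int.units_mul_self, one_mul]

theorem lie_mem_skewSub (hX : X ∈ skewSub σ ρ n A) (hY : Y ∈ skewSub σ ρ n B)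
    (hAB : ∀ a ∈ A, ∀ b ∈ B, a * b ∈ C ∧ b * a ∈ C) : ⁅X, Y⁆ ∈ skewSub σ ρ n C := by
  intro p q
  rw [Ring.lie_def]
  constructor
  · rw [Matrix.sub_apply, Matrix.mul_apply, Matrix.mul_apply]
    exact sub_mem (sum_mem fun r _ => (hAB _ (hX p r).1 _ (hY r q).1).1)
      (sum_mem fun r _ => (hAB _ (hX r q).1 _ (hY p r).1).2)
  · rw [Matrix.sub_apply, map_sub, apply_mul_of_mem_skewSub hX hY, apply_mul_of_mem_skewSub hY hX,
      Matrix.sub_apply, ← smul_sub, ← smul_neg, neg_sub]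

variable (hA : ∀ a ∈ A, σ.toLin a ∈ A)
include hA

theorem fMap_mem_skewSub (i j : Fin n) {a : R} (ha : a ∈ A) :
    fMap σ i j a ∈ skewSub σ ρ n A := by
  have h := hA a ha
  rintro (p | p) (q | q) <;>
    simp only [fMap_apply, Matrix.sub_apply, Matrix.single_apply, indexSign, Sum.elim_inl, Sum.elim_inr,
      Sum.swap_inl, Sum.swap_inr, Sum.inl.injEq, Sum.inr.injEq, reduceCtorEq, and_false, false_and,
      if_false, sub_zero, zero_sub, mul_one, Int.units_mul_self, Units.val_one, one_smul,
      map_zero, smul_zero, neg_zero, zero_mem, and_self, and_comm (a := i = _)] <;>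
    (try split_ifs) <;> simp [ha, h, σ.invol']

theorem gMap_mem_skewSub (i j : Fin n) {a : R} (ha : a ∈ A) :
    gMap σ ρ i j a ∈ skewSub σ ρ n A := by
  have h := hA a ha
  rintro (p | p) (q | q) <;>
    rcases Int.units_eq_one_or ρ with rfl | rfl <;>
    simp only [gMap_apply, Matrix.sub_apply, Matrix.smul_apply, Matrix.single_apply, indexSign, Sum.elim_inl,
      Sum.elim_inr, Sum.swap_inl, Sum.swap_inr, Sum.inl.injEq, Sum.inr.injEq, reduceCtorEq,
      and_false, false_and, if_false, sub_zero, mul_one, map_zero, smul_zero, neg_zero,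
      zero_mem, and_self, and_comm (a := i = _)] <;>
    (try split_ifs) <;> simp [ha, h, σ.invol', add_mem, sub_eq_add_neg, add_comm]

theorem hMap_mem_skewSub (i j : Fin n) {a : R} (ha : a ∈ A) :
    hMap σ ρ i j a ∈ skewSub σ ρ n A := by
  have h := hA a ha
  rintro (p | p) (q | q) <;>
    rcases Int.units_eq_one_or ρ with rfl | rfl <;>
    simp only [hMap_apply, Matrix.sub_apply, Matrix.smul_apply, Matrix.single_apply, indexSign, Sum.elim_inl,
      Sum.elim_inr, Sum.swap_inl, Sum.swap_inr, Sum.inl.injEq, Sum.inr.injEq, reduceCtorEq,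
      and_false, false_and, if_false, sub_zero, mul_one, map_zero, smul_zero, neg_zero,
      zero_mem, and_self, and_comm (a := i = _)] <;>
    (try split_ifs) <;> simp [ha, h, σ.invol', add_mem, sub_eq_add_neg, add_comm]

omit hA

theorem mem_skewSub_of_mem_gLie (hX : X ∈ gLie n ρ σ) : X ∈ skewSub σ ρ n ⊤ := by
  let S : LieSubalgebra k (Mat n R) :=
    { skewSub σ ρ n ⊤ with
      lie_mem' := fun hX hY => lie_mem_skewSub hX hY fun _ _ _ _ => ⟨trivial, trivial⟩ }
  have h : gLie n ρ σ ≤ S := by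
    refine LieSubalgebra.lieSpan_le.2 ?_
    rintro _ ((⟨i, j, a, -, rfl⟩ | ⟨i, j, a, -, rfl⟩) | ⟨i, j, a, -, rfl⟩)
    · exact fMap_mem_skewSub (fun _ _ => Submodule.mem_top) i j Submodule.mem_top
    · exact gMap_mem_skewSub (fun _ _ => Submodule.mem_top) i j Submodule.mem_top
    · exact hMap_mem_skewSub (fun _ _ => Submodule.mem_top) i j Submodule.mem_top
  exact h hX

end Skew

/-! ### The trace criterion for membership in `underG` -/

section Ideal

variable {k R : Type*} [CommRing k] [Ring R] [Algebra k R] {σ : Involution k R} {ρ : ℤˣ} {n : ℕ}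
  {X Y : Mat n R} {J : TwoSidedIdeal R}

theorem mul_sub_mul_mem_comm {a b : R} (h : a ∈ J ∨ b ∈ J) :
    a * b - b * a ∈ comm (idealSub k J) ⊤ := by
  rcases h with h | h
  · exact Submodule.subset_span ⟨a, h, b, trivial, rfl⟩
  · rw [← neg_sub]
    exact neg_mem (Submodule.subset_span ⟨b, h, a, trivial, rfl⟩)

/-- By skewness the involution sends the trace of `X₁₂Y₂₁` to that of `Y₂₁X₁₂`, so this trace is
symmetric modulo commutators. -/
theorem sum_sub_apply_sum_mem_comm (hX : X ∈ skewSub σ ρ n ⊤) (hY : Y ∈ skewSub σ ρ n ⊤)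
    (h : (∀ p q, X p q ∈ J) ∨ ∀ p q, Y p q ∈ J) :
    ∑ i : Fin n, ∑ j : Fin n, X (Sum.inl i) (Sum.inr j) * Y (Sum.inr j) (Sum.inl i)
      - σ.toLin (∑ i : Fin n, ∑ j : Fin n,
          X (Sum.inl i) (Sum.inr j) * Y (Sum.inr j) (Sum.inl i))
      ∈ comm (idealSub k J) ⊤ := by
  have key (i j : Fin n) :
      σ.toLin (X (Sum.inl i) (Sum.inr j) * Y (Sum.inr j) (Sum.inl i))
        = Y (Sum.inr i) (Sum.inl j) * X (Sum.inl j) (Sum.inr i) := by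
    have h1 := (hX (Sum.inl j) (Sum.inr i)).2
    have h2 := (hY (Sum.inr i) (Sum.inl j)).2
    simp only [Sum.swap_inl, Sum.swap_inr, indexSign, Sum.elim_inl, Sum.elim_inr, mul_one,
      one_mul] at h1 h2
    rw [σ.map_mul', h1, h2, neg_mul_neg, smul_mul_smul_comm, mul_smul, units_smul_smul]
  simp only [map_sum, key]
  rw [Finset.sum_comm (f := fun i j => Y (Sum.inr i) (Sum.inl j) * X (Sum.inl j) (Sum.inr i)),
    ← Finset.sum_sub_distrib]
  refine sum_mem fun i _ => ?_
  rw [← Finset.sum_sub_distrib]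
  exact sum_mem fun j _ => mul_sub_mul_mem_comm (h.imp (fun h => h _ _) (fun h => h _ _))

theorem gMap_mem_deltaSub (hJ : IsInvolutive σ J) {a : R} (ha : a ∈ J) (i j : Fin n) :
    gMap σ ρ i j a ∈ deltaSub n ρ σ J := by
  have key {i j : Fin n} (h : i ≤ j) {a : R} (ha : a ∈ J) :
      gMap σ ρ i j a ∈ deltaSub n ρ σ J :=
    Submodule.mem_sup_right <| Submodule.mem_iSup_of_mem i <| Submodule.mem_iSup_of_mem j <|
      Submodule.mem_iSup_of_mem h <| Submodule.mem_sup_left ⟨a, ha, rfl⟩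
  rcases le_total i j with h | h
  · exact key h ha
  · rw [gMap_swap]
    exact neg_mem (zsmul_mem (key h (hJ a ha)) _)

theorem hMap_mem_deltaSub (hJ : IsInvolutive σ J) {a : R} (ha : a ∈ J) (i j : Fin n) :
    hMap σ ρ i j a ∈ deltaSub n ρ σ J := by
  have key {i j : Fin n} (h : i ≤ j) {a : R} (ha : a ∈ J) :
      hMap σ ρ i j a ∈ deltaSub n ρ σ J :=
    Submodule.mem_sup_right <| Submodule.mem_iSup_of_mem i <| Submodule.mem_iSup_of_mem j <|
      Submodule.mem_iSup_of_mem h <| Submodule.mem_sup_right ⟨a, ha, rfl⟩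
  rcases le_total i j with h | h
  · exact key h ha
  · rw [hMap_swap]
    exact neg_mem (zsmul_mem (key h (hJ a ha)) _)

theorem underG_le_skewSub [NeZero n] (hJ : IsInvolutive σ J) :
    underG n ρ σ J ≤ skewSub σ ρ n (idealSub k J) := by
  have hJ' : ∀ a ∈ idealSub k J, σ.toLin a ∈ idealSub k J := hJ
  refine sup_le (sup_le ?_ ?_) (sup_le ?_ ?_)
  · rintro _ ⟨a, ha, rfl⟩
    refine fMap_mem_skewSub hJ' _ _ ?_
    refine (sup_le inf_le_right (Submodule.span_le.2 ?_) : _ ≤ idealSub k J) ha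
    rintro _ ⟨b, hb, c, -, rfl⟩
    exact sub_mem (J.mul_mem_right b c hb) (J.mul_mem_left c b hb)
  · refine iSup₂_le fun i _ => ?_
    rintro _ ⟨a, ha, rfl⟩
    exact sub_mem (fMap_mem_skewSub hJ' _ _ ha) (fMap_mem_skewSub hJ' _ _ ha)
  · refine iSup₂_le fun i j => iSup_le fun _ => ?_
    rintro _ ⟨a, ha, rfl⟩
    exact fMap_mem_skewSub hJ' _ _ ha
  · refine iSup₂_le fun i j => iSup_le fun _ => sup_le ?_ ?_
    · rintro _ ⟨a, ha, rfl⟩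
      exact gMap_mem_skewSub hJ' _ _ ha
    · rintro _ ⟨a, ha, rfl⟩
      exact hMap_mem_skewSub hJ' _ _ ha

end Ideal

section UnderG

variable {k R : Type*} [Field k] [NeZero (2 : k)] [Ring R] [Algebra k R] {σ : Involution k R}
  {ρ : ℤˣ} {n : ℕ} {X Y : Mat n R} {J : TwoSidedIdeal R}

theorem mem_symm_inf_sup_comm (hJ : IsInvolutive σ J) {a : R} (ha : a ∈ J)
    (h : a - σ.toLin a ∈ comm (idealSub k J) ⊤) :
    a ∈ (symm σ ⊓ idealSub k J) ⊔ comm (idealSub k J) ⊤ := by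
  have h2 : (2 : k)⁻¹ • (a + σ.toLin a) + (2 : k)⁻¹ • (a - σ.toLin a) = a := by
    rw [← smul_add, add_add_sub_cancel, ← two_smul k, inv_smul_smul₀ two_ne_zero]
  rw [← h2]
  refine Submodule.add_mem_sup ⟨?_, ?_⟩ (Submodule.smul_mem _ _ h)
  · refine Submodule.smul_mem _ _ (mem_symm.2 ?_)
    rw [map_add, σ.invol', add_comm]
  · exact Submodule.smul_mem _ _ (add_mem (S := Submodule k R) ha (hJ a ha))

/-- The trace of the upper left block splits into commutators, from `X₁₁` and `Y₁₁`, and the traces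
of `X₁₂Y₂₁` and `Y₁₂X₂₁`, which are symmetric modulo `[J,R]`. -/
theorem sum_diag_lie_mem (hJ : IsInvolutive σ J) (hX : X ∈ skewSub σ ρ n ⊤)
    (hY : Y ∈ skewSub σ ρ n (idealSub k J)) :
    ∑ i : Fin n, ⁅X, Y⁆ (Sum.inl i) (Sum.inl i)
      ∈ (symm σ ⊓ idealSub k J) ⊔ comm (idealSub k J) ⊤ := by
  have hY' : Y ∈ skewSub σ ρ n ⊤ := skewSub_mono le_top hY
  have hYJ (p q) : Y p q ∈ J := (hY p q).1
  have e : ∑ i : Fin n, ⁅X, Y⁆ (Sum.inl i) (Sum.inl i)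
      = ∑ i : Fin n, ∑ j : Fin n, (X (Sum.inl i) (Sum.inl j) * Y (Sum.inl j) (Sum.inl i)
          - Y (Sum.inl j) (Sum.inl i) * X (Sum.inl i) (Sum.inl j))
        + ∑ i : Fin n, ∑ j : Fin n, X (Sum.inl i) (Sum.inr j) * Y (Sum.inr j) (Sum.inl i)
        - ∑ i : Fin n, ∑ j : Fin n, Y (Sum.inl i) (Sum.inr j) * X (Sum.inr j) (Sum.inl i) := by
    simp only [Ring.lie_def, Matrix.sub_apply, Matrix.mul_apply, Fintype.sum_sum_type, Finset.sum_sub_distrib,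
      Finset.sum_add_distrib]
    rw [Finset.sum_comm
      (f := fun i j : Fin n => Y (Sum.inl j) (Sum.inl i) * X (Sum.inl i) (Sum.inl j))]
    abel
  rw [e]
  refine sub_mem (add_mem (Submodule.mem_sup_right ?_) (mem_symm_inf_sup_comm hJ ?_ ?_))
    (mem_symm_inf_sup_comm hJ ?_ ?_)
  · exact sum_mem fun i _ => sum_mem fun j _ => mul_sub_mul_mem_comm (.inr (hYJ _ _))
  · exact sum_mem fun i _ => sum_mem fun j _ => J.mul_mem_left _ _ (hYJ _ _)
  · exact sum_sub_apply_sum_mem_comm hX hY' (.inr hYJ)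
  · exact sum_mem fun i _ => sum_mem fun j _ => J.mul_mem_right _ _ (hYJ _ _)
  · exact sum_sub_apply_sum_mem_comm hY' hX (.inl hYJ)

/-- The factor `1/2` arises because summing over all `(i, j)` meets each off-diagonal block entry
twice, once from `(i, j)` and once from `(j, i)`. -/
theorem eq_sum_of_mem_skewSub (hX : X ∈ skewSub σ ρ n ⊤) :
    X = ∑ i : Fin n, ∑ j : Fin n, fMap σ i j (X (Sum.inl i) (Sum.inl j))
      + (2 : k)⁻¹ • (∑ i : Fin n, ∑ j : Fin n, gMap σ ρ i j (X (Sum.inl i) (Sum.inr j))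
        + ∑ i : Fin n, ∑ j : Fin n, hMap σ ρ i j (X (Sum.inr i) (Sum.inl j))) := by
  have hf (i j : Fin n) : fMap σ i j (X (Sum.inl i) (Sum.inl j))
      = single (Sum.inl i) (Sum.inl j) (X (Sum.inl i) (Sum.inl j))
        + single (Sum.inr j) (Sum.inr i) (X (Sum.inr j) (Sum.inr i)) := by
    have h := (hX (Sum.inr j) (Sum.inr i)).2
    simp only [Sum.swap_inr, indexSign, Sum.elim_inr, Int.units_mul_self, Units.val_one,
      one_smul] at h
    rw [fMap_apply, h, ← single_neg, sub_neg_eq_add]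
  have hg (i j : Fin n) : gMap σ ρ i j (X (Sum.inl i) (Sum.inr j))
      = single (Sum.inl i) (Sum.inr j) (X (Sum.inl i) (Sum.inr j))
        + single (Sum.inl j) (Sum.inr i) (X (Sum.inl j) (Sum.inr i)) := by
    have h := (hX (Sum.inl j) (Sum.inr i)).2
    simp only [Sum.swap_inr, Sum.swap_inl, indexSign, Sum.elim_inr, Sum.elim_inl, one_mul] at h
    rw [gMap_apply, h, ← single_neg, smul_neg, sub_neg_eq_add, smul_single, units_smul_smul]
  have hh (i j : Fin n) : hMap σ ρ i j (X (Sum.inr i) (Sum.inl j))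
      = single (Sum.inr i) (Sum.inl j) (X (Sum.inr i) (Sum.inl j))
        + single (Sum.inr j) (Sum.inl i) (X (Sum.inr j) (Sum.inl i)) := by
    have h := (hX (Sum.inr j) (Sum.inl i)).2
    simp only [Sum.swap_inr, Sum.swap_inl, indexSign, Sum.elim_inr, Sum.elim_inl, mul_one] at h
    rw [hMap_apply, h, ← single_neg, smul_neg, sub_neg_eq_add, smul_single, units_smul_smul]
  simp only [hf, hg, hh, Finset.sum_add_distrib]
  rw [Finset.sum_comm (f := fun i j : Fin n =>
      single (Sum.inr j : Fin n ⊕ Fin n) (Sum.inr i) (X (Sum.inr j) (Sum.inr i))),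
    Finset.sum_comm (f := fun i j : Fin n =>
      single (Sum.inl j : Fin n ⊕ Fin n) (Sum.inr i) (X (Sum.inl j) (Sum.inr i))),
    Finset.sum_comm (f := fun i j : Fin n =>
      single (Sum.inr j : Fin n ⊕ Fin n) (Sum.inl i) (X (Sum.inr j) (Sum.inl i))),
    ← two_smul k, ← two_smul k, ← smul_add, inv_smul_smul₀ two_ne_zero]
  conv_lhs => rw [matrix_eq_sum_single X]
  simp only [Fintype.sum_sum_type, Finset.sum_add_distrib]
  abel

theorem mem_underG_of_sum_diag_mem [NeZero n] (hJ : IsInvolutive σ J)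
    (hX : X ∈ skewSub σ ρ n (idealSub k J))
    (htr : ∑ i : Fin n, X (Sum.inl i) (Sum.inl i)
      ∈ (symm σ ⊓ idealSub k J) ⊔ comm (idealSub k J) ⊤) :
    X ∈ underG n ρ σ J := by
  have hXJ (p q) : X p q ∈ J := (hX p q).1
  have hdiag : ∑ i : Fin n, fMap σ i i (X (Sum.inl i) (Sum.inl i)) ∈ underG n ρ σ J := by
    -- Moving every diagonal entry to position `0` costs only elements of `diagSub` and leaves the
    -- trace there.
    have e : ∑ i : Fin n, fMap σ i i (X (Sum.inl i) (Sum.inl i))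
        = fMap σ 0 0 (∑ i : Fin n, X (Sum.inl i) (Sum.inl i))
          + ∑ i : Fin n, (fMap σ i i - fMap σ 0 0 : R →ₗ[k] Mat n R) (X (Sum.inl i) (Sum.inl i)) := by
      simp [map_sum]
    rw [e]
    refine Submodule.mem_sup_left (Submodule.add_mem_sup ⟨_, htr, rfl⟩ (sum_mem fun i _ => ?_))
    rcases eq_or_ne i 0 with rfl | hi
    · simp
    · exact Submodule.mem_iSup_of_mem i (Submodule.mem_iSup_of_mem hi ⟨_, hXJ _ _, rfl⟩)
  rw [eq_sum_of_mem_skewSub (k := k) (skewSub_mono le_top hX)]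
  refine add_mem ?_ (Submodule.smul_mem _ _ (Submodule.mem_sup_right (add_mem ?_ ?_)))
  · have e (i : Fin n) : ∑ j : Fin n, fMap σ i j (X (Sum.inl i) (Sum.inl j))
        = fMap σ i i (X (Sum.inl i) (Sum.inl i))
          + ∑ j ∈ Finset.univ.erase i, fMap σ i j (X (Sum.inl i) (Sum.inl j)) :=
      (Finset.add_sum_erase _ _ (Finset.mem_univ i)).symm
    simp only [e, Finset.sum_add_distrib]
    refine add_mem hdiag (sum_mem fun i _ => sum_mem fun j hj => ?_)
    exact Submodule.mem_sup_right <| Submodule.mem_sup_left <| Submodule.mem_iSup_of_mem i <|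
      Submodule.mem_iSup_of_mem j <| Submodule.mem_iSup_of_mem (Finset.ne_of_mem_erase hj).symm
        ⟨_, hXJ _ _, rfl⟩
  · exact sum_mem fun i _ => sum_mem fun j _ => gMap_mem_deltaSub hJ (hXJ _ _) i j
  · exact sum_mem fun i _ => sum_mem fun j _ => hMap_mem_deltaSub hJ (hXJ _ _) i j

theorem lie_mem_underG [NeZero n] (hJ : IsInvolutive σ J) (hX : X ∈ skewSub σ ρ n ⊤)
    (hY : Y ∈ skewSub σ ρ n (idealSub k J)) : ⁅X, Y⁆ ∈ underG n ρ σ J :=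
  mem_underG_of_sum_diag_mem hJ
    (lie_mem_skewSub hX hY fun a _ b hb => ⟨J.mul_mem_left a b hb, J.mul_mem_right b a hb⟩)
    (sum_diag_lie_mem hJ hX hY)

end UnderG

end BCGraded

/-! ### Ideals abelian modulo an ideal with semisimple quotient -/

theorem LieIdeal.le_of_lie_mem_of_hasTrivialRadical {k L : Type*} [CommRing k] [LieRing L]
    [LieAlgebra k L] {𝒥 N : LieIdeal k L} (hss : LieAlgebra.HasTrivialRadical k (L ⧸ 𝒥))
    (h : ∀ x ∈ N, ∀ y ∈ N, ⁅x, y⁆ ∈ 𝒥) : N ≤ 𝒥 := by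
  let I : LieIdeal k (L ⧸ 𝒥) :=
    { N.toSubmodule.map (LieSubmodule.Quotient.mk' 𝒥 : L →ₗ[k] L ⧸ 𝒥) with
      lie_mem := by
        rintro x _ ⟨y, hy, rfl⟩
        obtain ⟨x, rfl⟩ := LieSubmodule.Quotient.surjective_mk' 𝒥 x
        exact ⟨⁅x, y⁆, N.lie_mem hy, rfl⟩ }
  have hI : IsLieAbelian I := by
    refine ⟨?_⟩
    rintro ⟨_, x, hx, rfl⟩ ⟨_, y, hy, rfl⟩
    exact Subtype.ext ((LieSubmodule.Quotient.mk_eq_zero (N := 𝒥)).2 (h x hx y hy))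
  have hbot := (LieAlgebra.hasTrivialRadical_iff_no_abelian_ideals k (L ⧸ 𝒥)).1 hss I hI
  intro x hx
  have hxI : LieSubmodule.Quotient.mk' 𝒥 x ∈ I := ⟨x, hx, rfl⟩
  rw [hbot, LieSubmodule.mem_bot] at hxI
  exact (LieSubmodule.Quotient.mk_eq_zero (N := 𝒥)).1 hxI

/-! ### Separable polynomials and their values -/

namespace Polynomial

variable {k : Type*} [Field k]

theorem exists_ne_zero_map_aeval_eq_zero {R V : Type*} [Ring R] [Algebra k R] [AddCommGroup V]
    [Module k V] [FiniteDimensional k V] (φ : R →ₗ[k] V) (s : R) :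
    ∃ p : k[X], p ≠ 0 ∧ φ (aeval s p) = 0 := by
  by_contra! h
  have hinj : Function.Injective (φ ∘ₗ (aeval s).toLinearMap) := by
    rw [injective_iff_map_eq_zero]
    intro p hp
    by_contra hne
    exact h p hne hp
  exact Polynomial.not_finite (Module.Finite.of_injective _ hinj)

theorem exists_separable_aeval_pow_mem [CharZero k] {R : Type*} [Ring R] [Algebra k R]
    {J : TwoSidedIdeal R} {s s' : R} (hs : s' * s = 1) {p : k[X]} (hp : p ≠ 0)
    (hpJ : aeval s p ∈ J) :
    ∃ f : k[X], f.eval 0 ≠ 0 ∧ 0 < f.natDegree ∧ f.Separable ∧ ∃ N : ℕ, aeval s f ^ N ∈ J := by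
  classical
  obtain ⟨p', hpp', hp'⟩ := exists_eq_pow_rootMultiplicity_mul_and_not_dvd p hp 0
  rw [map_zero, sub_zero] at hpp' hp'
  have hp'J : aeval s p' ∈ J := by
    -- The left inverse of `s` cancels the factor `X ^ rootMultiplicity 0 p`.
    have h := J.mul_mem_left (s' ^ rootMultiplicity 0 p) _ hpJ
    have hpow (m : ℕ) : s' ^ m * s ^ m = 1 := by
      induction m with
      | zero => simp
      | succ m ih => rw [pow_succ, pow_succ', mul_assoc, ← mul_assoc s', hs, one_mul, ih]
    rwa [hpp', map_mul, map_pow, aeval_X, ← mul_assoc, ← hpp', hpow, one_mul] at h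
  rw [X_dvd_iff, coeff_zero_eq_eval_zero] at hp'
  -- The extra root `1` forces positive degree even when `p'` is constant, and keeps `0` from being
  -- a root.
  set P := p' * (X - C 1) with hPdef
  have hP0 : P.eval 0 ≠ 0 := by simpa [P] using hp'
  have hP : P ≠ 0 := by rintro h; simp [h] at hP0
  refine ⟨UniqueFactorizationMonoid.radical P, fun h => hP0 ?_, ?_, ?_, ?_⟩
  · exact eval_eq_zero_of_dvd_of_eval_eq_zero UniqueFactorizationMonoid.radical_dvd_self h
  · have h : X - C 1 ∣ UniqueFactorizationMonoid.radical P :=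
      (UniqueFactorizationMonoid.dvd_radical_iff_of_irreducible (irreducible_X_sub_C 1) hP).2
        (Dvd.intro_left _ rfl)
    have h := natDegree_le_of_dvd h UniqueFactorizationMonoid.radical_ne_zero
    rw [natDegree_X_sub_C] at h
    exact h
  · exact PerfectField.separable_iff_squarefree.2 UniqueFactorizationMonoid.squarefree_radical
  · obtain ⟨N, g, hg⟩ := UniqueFactorizationMonoid.exists_dvd_radical_self_pow hP
    refine ⟨N, ?_⟩
    rw [← map_pow, hg, hPdef, map_mul, map_mul]
    exact J.mul_mem_right _ _ (J.mul_mem_right _ _ hp'J)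

/-- The derivative of `f(X²)` is `f'(X²) · 2X`, and `f(0) ≠ 0` makes `X` coprime to `f(X²)`. -/
theorem Separable.expand_two [CharZero k] {f : k[X]} (hf : f.Separable) (h0 : f.eval 0 ≠ 0) :
    (expand k 2 f).Separable := by
  rw [separable_def, derivative_expand]
  refine IsCoprime.mul_right (IsCoprime.map hf (expand k 2 : k[X] →+* k[X])) (IsCoprime.mul_right ?_ ?_)
  · refine isCoprime_one_right.of_isCoprime_of_dvd_right (IsUnit.dvd ?_)
    rw [← C_eq_natCast]
    exact isUnit_C.2 (by simp)
  · rw [pow_one, isCoprime_comm, irreducible_X.coprime_iff_not_dvd, X_dvd_iff,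
      coeff_zero_eq_eval_zero, expand_eval]
    simpa using h0

/-- A polynomial `f` in `T²` rewritten as a polynomial in `Tᵐ`, `m = 1, 2` the order of a sign. -/
theorem exists_aeval_pow_orderOf_eq [CharZero k] (q : ℤˣ) {c : k} (hc : c * c = 1) {f₀ : k[X]}
    (h0 : f₀.eval 0 ≠ 0) (hdeg : 0 < f₀.natDegree) (hsep : f₀.Separable) :
    ∃ f : k[X], f.eval 0 ≠ 0 ∧ 0 < f.natDegree ∧ IsCoprime f (derivative f) ∧
      f.comp (C (c ^ orderOf q) * X) = f ∧
      ∀ {R : Type} [Ring R] [Algebra k R] (x : R), aeval (x ^ orderOf q) f = aeval (x ^ 2) f₀ := by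
  rcases Int.units_eq_one_or q with rfl | rfl
  · refine ⟨expand k 2 f₀, by simpa [expand_eval] using h0, ?_, hsep.expand_two h0, ?_, ?_⟩
    · rw [natDegree_expand]; positivity
    · rw [orderOf_one, pow_one, expand_eq_comp_X_pow, comp_assoc]
      congr 1
      rw [pow_comp, X_comp, mul_pow, ← C_pow, sq c, hc, C_1, one_mul]
    · intro R _ _ x
      rw [expand_aeval, orderOf_one, pow_one]
  · have ho : orderOf (-1 : ℤˣ) = 2 := orderOf_eq_prime (by simp) (by decide)
    refine ⟨f₀, h0, hdeg, hsep, ?_, ?_⟩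
    · rw [ho, sq, hc, C_1, one_mul, comp_X]
    · intro R _ _ x
      rw [ho]

end Polynomial

namespace BCGraded

/-! ### Central symmetric elements -/

section CentralFixed

variable {k R : Type*} [CommRing k] [Ring R] [Algebra k R] (σ : Involution k R)

/-- The central elements fixed by the involution. -/
def centralFixed : Subalgebra k R where
  carrier := {w | (∀ r, w * r = r * w) ∧ σ.toLin w = w}
  mul_mem' {a b} ha hb := by
    refine ⟨fun r => ?_, ?_⟩
    · rw [mul_assoc, hb.1, ← mul_assoc, ha.1, mul_assoc]
    · rw [σ.map_mul', ha.2, hb.2, hb.1]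
  add_mem' {a b} ha hb := by
    refine ⟨fun r => ?_, ?_⟩
    · rw [add_mul, mul_add, ha.1, hb.1]
    · rw [map_add, ha.2, hb.2]
  algebraMap_mem' c := by
    refine ⟨Algebra.commutes c, ?_⟩
    rw [Algebra.algebraMap_eq_smul_one, map_smul, σ.map_one]

variable {σ}

theorem mem_centralFixed {w : R} :
    w ∈ centralFixed σ ↔ (∀ r, w * r = r * w) ∧ σ.toLin w = w := Iff.rfl

theorem aeval_mem_centralFixed {w : R} (hw : w ∈ centralFixed σ) (p : Polynomial k) :
    Polynomial.aeval w p ∈ centralFixed σ :=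
  Algebra.adjoin_le (Set.singleton_subset_iff.2 hw) (Polynomial.aeval_mem_adjoin_singleton k w)

end CentralFixed

section Quotient

variable {k R : Type*} [CommRing k] [Ring R] [Algebra k R] {σ : Involution k R} {ρ : ℤˣ} {n : ℕ}

/-- The ideal of `𝔤_{2n,ρ}(R)` of the matrices with entries in an ideal of `R`. -/
def skewLieIdeal (n : ℕ) (ρ : ℤˣ) (σ : Involution k R) (A : Submodule k R)
    (hA : ∀ r, ∀ a ∈ A, r * a ∈ A ∧ a * r ∈ A) : LieIdeal k (gLie n ρ σ) where
  toSubmodule := (skewSub σ ρ n A).comap (gLie n ρ σ).toSubmodule.subtype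
  lie_mem {x _} hy := lie_mem_skewSub (mem_skewSub_of_mem_gLie x.2) hy fun r _ a ha => hA r a ha

variable (𝒥 : LieIdeal k (gLie n ρ σ))

/-- An ideal of `𝔤_{2n,ρ}(R)`, as a space of matrices. -/
def ambient : Submodule k (Mat n R) := 𝒥.toSubmodule.map (gLie n ρ σ).toSubmodule.subtype

theorem mem_ambient {x : gLie n ρ σ} : (x : Mat n R) ∈ ambient 𝒥 ↔ x ∈ 𝒥 := by
  constructor
  · rintro ⟨y, hy, hyx⟩
    rwa [← Subtype.ext hyx]
  · exact fun h => ⟨x, h, rfl⟩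

theorem lie_mem_ambient : ∀ x ∈ gLie n ρ σ, ∀ y ∈ ambient 𝒥, ⁅x, y⁆ ∈ ambient 𝒥 := by
  rintro x hx _ ⟨y, hy, rfl⟩
  exact ⟨⁅⟨x, hx⟩, y⁆, 𝒥.lie_mem hy, rfl⟩

theorem exists_ne_zero_aeval_mem_coeffIdeal {k R : Type*} [Field k] [Ring R] [Algebra k R]
    {σ : Involution k R} {𝒥 : LieIdeal k (gLie n ρ σ)} (hn : 3 ≤ n)
    (hfin : FiniteDimensional k (gLie n ρ σ ⧸ 𝒥)) (s : R) :
    ∃ p : Polynomial k, p ≠ 0 ∧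
      Polynomial.aeval s p ∈ coeffIdeal hn (lie_mem_ambient 𝒥) := by
  -- The kernel of `φ` is the coefficient ideal; taking all root positions at once yields a single
  -- polynomial.
  let φ : R →ₗ[k] ({ij : Fin n × Fin n // ij.1 ≠ ij.2} → gLie n ρ σ ⧸ 𝒥) :=
    LinearMap.pi fun ij => (LieSubmodule.Quotient.mk' 𝒥 : gLie n ρ σ →ₗ[k] gLie n ρ σ ⧸ 𝒥) ∘ₗ
      (fMap σ ij.1.1 ij.1.2).codRestrict (gLie n ρ σ).toSubmodule
        (fun a => fMap_mem_gLie σ ρ ij.2 a)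
  obtain ⟨p, hp, h⟩ := Polynomial.exists_ne_zero_map_aeval_eq_zero φ s
  refine ⟨p, hp, (mem_coeffIdeal _ hn).2 fun i j hij => ?_⟩
  exact (mem_ambient 𝒥 (x := ⟨_, fMap_mem_gLie σ ρ hij _⟩)).2
    ((LieSubmodule.Quotient.mk_eq_zero (N := 𝒥)).1 (congrFun h ⟨(i, j), hij⟩))

end Quotient

/-! ### Removing powers by semisimplicity -/

section Semiprime

variable {k R : Type*} [Field k] [NeZero (2 : k)] [Ring R] [Algebra k R] {σ : Involution k R}
  {ρ : ℤˣ} {n : ℕ} [NeZero n] {𝒥 : LieIdeal k (gLie n ρ σ)}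

theorem mem_coeffIdeal_of_mul_self_mem (hn : 3 ≤ n)
    (hss : LieAlgebra.HasTrivialRadical k (gLie n ρ σ ⧸ 𝒥)) {z : R} (hz : z ∈ centralFixed σ)
    (h : z * z ∈ coeffIdeal hn (lie_mem_ambient 𝒥)) :
    z ∈ coeffIdeal hn (lie_mem_ambient 𝒥) := by
  set J := coeffIdeal hn (lie_mem_ambient 𝒥)
  have hJ : IsInvolutive σ J := isInvolutive_coeffIdeal _ hn
  have hJP : underG n ρ σ J ≤ ambient 𝒥 :=
    underG_le hn (lie_mem_ambient 𝒥) fun a ha => (mem_coeffIdeal _ hn).1 ha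
  have hA {w : R} (hw : w ∈ centralFixed σ) : ∀ r, ∀ a ∈ LinearMap.range (LinearMap.mulLeft k w),
      r * a ∈ LinearMap.range (LinearMap.mulLeft k w) ∧
        a * r ∈ LinearMap.range (LinearMap.mulLeft k w) := by
    rintro r _ ⟨b, rfl⟩
    refine ⟨⟨r * b, ?_⟩, ⟨b * r, ?_⟩⟩
    · simp only [LinearMap.mulLeft_apply]
      rw [← mul_assoc, hw.1, mul_assoc]
    · simp only [LinearMap.mulLeft_apply, mul_assoc]
  have hzz := mul_mem hz hz
  -- Entries in `z²R ⊆ J` do not by themselves give membership in `underG`, because of the trace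
  -- condition; brackets satisfy it, so this ideal is abelian modulo `𝒥`.
  have h1 : skewLieIdeal n ρ σ _ (hA hzz) ≤ 𝒥 := by
    refine LieIdeal.le_of_lie_mem_of_hasTrivialRadical hss fun x hx y hy => ?_
    refine (mem_ambient 𝒥).1 (hJP (lie_mem_underG hJ (skewSub_mono le_top hx)
      (skewSub_mono ?_ hy)))
    rintro _ ⟨b, rfl⟩
    exact J.mul_mem_right _ b h
  -- Centrality gives `(za)(zb) = z²ab`, so brackets fall into the ideal just handled.
  have h2 : skewLieIdeal n ρ σ _ (hA hz) ≤ 𝒥 := by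
    refine LieIdeal.le_of_lie_mem_of_hasTrivialRadical hss fun x hx y hy => h1 ?_
    refine lie_mem_skewSub hx hy ?_
    have key (a b : R) : z * a * (z * b) ∈ LinearMap.range (LinearMap.mulLeft k (z * z)) :=
      ⟨a * b, by
        rw [LinearMap.mulLeft_apply, mul_assoc z a, ← mul_assoc a, ← hz.1 a]
        simp only [mul_assoc]⟩
    rintro _ ⟨a, rfl⟩ _ ⟨b, rfl⟩
    exact ⟨key a b, key b a⟩
  refine (mem_coeffIdeal _ hn).2 fun i j hij => ?_
  refine (mem_ambient 𝒥 (x := ⟨_, fMap_mem_gLie σ ρ hij z⟩)).2 (h2 (fMap_mem_skewSub ?_ i j ?_))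
  · rintro _ ⟨b, rfl⟩
    refine ⟨σ.toLin b, ?_⟩
    rw [LinearMap.mulLeft_apply, LinearMap.mulLeft_apply, σ.map_mul', hz.2, hz.1]
  · exact ⟨1, mul_one z⟩

theorem mem_coeffIdeal_of_pow_mem (hn : 3 ≤ n)
    (hss : LieAlgebra.HasTrivialRadical k (gLie n ρ σ ⧸ 𝒥)) {z : R} (hz : z ∈ centralFixed σ)
    {N : ℕ} (h : z ^ N ∈ coeffIdeal hn (lie_mem_ambient 𝒥)) :
    z ∈ coeffIdeal hn (lie_mem_ambient 𝒥) := by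
  have key (m : ℕ) (hm : z ^ 2 ^ m ∈ coeffIdeal hn (lie_mem_ambient 𝒥)) :
      z ∈ coeffIdeal hn (lie_mem_ambient 𝒥) := by
    induction m with
    | zero => simpa using hm
    | succ m ih =>
      refine ih (mem_coeffIdeal_of_mul_self_mem hn hss (pow_mem hz _) ?_)
      rwa [← pow_add, ← two_mul, ← pow_succ']
  -- Only squares can be removed, so the exponent is raised from `N` to `2 ^ N`.
  refine key N ?_
  rw [← Nat.sub_add_cancel (Nat.lt_two_pow_self (n := N)).le, pow_add]
  exact TwoSidedIdeal.mul_mem_left _ _ _ h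

theorem exists_separable_aeval_mem_coeffIdeal [CharZero k] (hn : 3 ≤ n)
    (hfin : FiniteDimensional k (gLie n ρ σ ⧸ 𝒥))
    (hss : LieAlgebra.HasTrivialRadical k (gLie n ρ σ ⧸ 𝒥)) {s s' : R}
    (hs : s ∈ centralFixed σ) (hs' : s' * s = 1) :
    ∃ f : Polynomial k, f.eval 0 ≠ 0 ∧ 0 < f.natDegree ∧ f.Separable ∧
      Polynomial.aeval s f ∈ coeffIdeal hn (lie_mem_ambient 𝒥) := by
  obtain ⟨p, hp, hpJ⟩ := exists_ne_zero_aeval_mem_coeffIdeal hn hfin s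
  obtain ⟨f, h0, hdeg, hsep, N, hN⟩ := Polynomial.exists_separable_aeval_pow_mem hs' hp hpJ
  exact ⟨f, h0, hdeg, hsep, mem_coeffIdeal_of_pow_mem hn hss (aeval_mem_centralFixed hs f) hN⟩

variable {J : TwoSidedIdeal R}

theorem underG_le_gLie (hn : 3 ≤ n) : underG n ρ σ J ≤ (gLie n ρ σ).toSubmodule :=
  underG_le hn (fun _ hx _ hy => (gLie n ρ σ).lie_mem hx hy)
    fun a _ _ _ hij => fMap_mem_gLie σ ρ hij a

/-- `underG` of an involutive ideal, as an ideal of `𝔤_{2n,ρ}(R)`. -/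
def underLieIdeal (n : ℕ) [NeZero n] (ρ : ℤˣ) (hJ : IsInvolutive σ J) :
    LieIdeal k (gLie n ρ σ) where
  toSubmodule := (underG n ρ σ J).comap (gLie n ρ σ).toSubmodule.subtype
  lie_mem {x _} hy :=
    lie_mem_underG hJ (mem_skewSub_of_mem_gLie x.2) (underG_le_skewSub hJ hy)

theorem map_underLieIdeal (hn : 3 ≤ n) (hJ : IsInvolutive σ J) :
    (underLieIdeal n ρ hJ).toSubmodule.map (gLie n ρ σ).toSubmodule.subtype = underG n ρ σ J :=
  Submodule.map_comap_eq_of_le (by rw [Submodule.range_subtype]; exact underG_le_gLie hn)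

theorem underLieIdeal_le (hn : 3 ≤ n) (hJ : IsInvolutive σ J)
    (h : J ≤ coeffIdeal hn (lie_mem_ambient 𝒥)) : underLieIdeal n ρ hJ ≤ 𝒥 := fun _ hx =>
  (mem_ambient 𝒥).1
    (underG_le hn (lie_mem_ambient 𝒥) (fun _ ha => (mem_coeffIdeal _ hn).1 (h ha)) hx)

end Semiprime

/-! ### Comparing `overG` and `underG` -/

section CommutatorPart

variable {k R : Type*} [Field k] [NeZero (2 : k)] [Ring R] [Algebra k R] {J : TwoSidedIdeal R}

/-- Conjugation by `u` sends `b + c` to `b - c`. Half the sum is `b`; half the difference is `c`,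
and `2c` is the commutator of `(b + c)v` with `u`. -/
theorem mem_and_mem_comm_of_anticommute {u v b c : R} (huv : u * v = 1)
    (hvu : v * u = 1) (hb : u * b = b * u) (hc : u * c = -(c * u)) (h : b + c ∈ J) :
    b ∈ J ∧ c ∈ comm (idealSub k J) ⊤ := by
  have hconj : u * (b + c) * v = b - c := by
    rw [mul_add, hb, hc, add_mul, neg_mul, mul_assoc, mul_assoc, huv, mul_one, mul_one,
      sub_eq_add_neg]
  have hJ : b - c ∈ J := hconj ▸ J.mul_mem_right _ _ (J.mul_mem_left _ _ h)
  constructor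
  · have h2 : (2 : k) • b ∈ idealSub k J := by
      have : (2 : k) • b = (b + c) + (b - c) := by rw [two_smul]; abel
      rw [this]
      exact add_mem (S := Submodule k R) h hJ
    exact ((idealSub k J).smul_mem_iff two_ne_zero).1 h2
  · have h2 : (2 : k) • c ∈ comm (idealSub k J) ⊤ := by
      have : (2 : k) • c = (b + c) * v * u - u * ((b + c) * v) := by
        rw [← mul_assoc, hconj, mul_assoc, hvu, mul_one, two_smul]
        abel
      rw [this]
      exact Submodule.subset_span ⟨_, J.mul_mem_right _ v h, u, trivial, rfl⟩
    exact ((comm (idealSub k J) ⊤).smul_mem_iff two_ne_zero).1 h2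

end CommutatorPart

section Comparison

variable {k R : Type*} [CommRing k] [Ring R] [Algebra k R] {J : TwoSidedIdeal R}

theorem overG_eq_underG_of_commute {σ : Involution k R} {ρ : ℤˣ} {n : ℕ} [NeZero n]
    (h : ∀ a b : R, a * b = b * a) : overG n ρ σ J = underG n ρ σ J := by
  have hbot (A B : Submodule k R) : comm A B = ⊥ := by
    refine Submodule.span_eq_bot.2 ?_
    rintro _ ⟨a, -, b, -, rfl⟩
    rw [h a b, sub_self]
  simp only [overG, underG, hbot, sup_bot_eq]

theorem overG_eq_underG_of_le {σ : Involution k R} {ρ : ℤˣ} {n : ℕ} [NeZero n]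
    (h : idealSub k J ≤ (symm σ ⊓ idealSub k J) ⊔ comm (idealSub k J) ⊤) :
    overG n ρ σ J = underG n ρ σ J := by
  have e : (symm σ ⊔ comm ⊤ ⊤) ⊓ idealSub k J
      = (symm σ ⊓ idealSub k J) ⊔ comm (idealSub k J) ⊤ := by
    refine le_antisymm (inf_le_right.trans h) (le_inf (sup_le_sup inf_le_left ?_)
      (sup_le inf_le_right (Submodule.span_le.2 ?_)))
    · exact Submodule.span_mono fun x ⟨a, _, b, _, hx⟩ => ⟨a, trivial, b, trivial, hx⟩
    · rintro _ ⟨a, ha, b, -, rfl⟩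
      exact sub_mem (J.mul_mem_right a b ha) (J.mul_mem_left b a ha)
  rw [overG, underG, e]

end Comparison

theorem isInvolutive_span {k R : Type*} [CommRing k] [Ring R] [Algebra k R] {σ : Involution k R}
    {S : Set R} (hS : ∀ a ∈ S, σ.toLin a ∈ S) : IsInvolutive σ (TwoSidedIdeal.span S) := by
  set J := TwoSidedIdeal.span S
  let K : TwoSidedIdeal R := TwoSidedIdeal.mk' {a | σ.toLin a ∈ J}
    (by simp)
    (fun ha hb => by
      rw [Set.mem_ofPred_eq, map_add]
      exact add_mem ha hb)
    (fun ha => by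
      rw [Set.mem_ofPred_eq, map_neg]
      exact neg_mem ha)
    (fun ha => by
      rw [Set.mem_ofPred_eq, σ.map_mul']
      exact J.mul_mem_right _ _ ha)
    (fun ha => by
      rw [Set.mem_ofPred_eq, σ.map_mul']
      exact J.mul_mem_left _ _ ha)
  have h : J ≤ K := TwoSidedIdeal.span_le.2 fun a ha =>
    (TwoSidedIdeal.mem_mk' _ _ _ _ _ _ _).2 (TwoSidedIdeal.subset_span (hS a ha))
  exact fun a ha => (TwoSidedIdeal.mem_mk' {a | σ.toLin a ∈ J} _ _ _ _ _ a).1 (h ha)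

/-! ### The quantum torus at `q = ±1` -/

section Torus

theorem adjoin_range_tgen (q : ℂ) : Algebra.adjoin ℂ (Set.range (tgen q)) = ⊤ := by
  have h : Set.range (tgen q)
      = RingQuot.mkAlgHom ℂ (TorusRel q) '' Set.range (FreeAlgebra.ι ℂ) := by
    rw [← Set.range_comp]
    rfl
  rw [h]
  refine (AlgHom.map_adjoin _ _).symm.trans ?_
  rw [FreeAlgebra.adjoin_range_ι]
  refine (Algebra.map_top _).trans ?_
  exact (AlgHom.range_eq_top _).2 (RingQuot.mkAlgHom_surjective ℂ _)

theorem mem_of_tgen_mem {q : ℂ} {S : Subalgebra ℂ (QTorus q)} (h : ∀ x, tgen q x ∈ S)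
    (a : QTorus q) : a ∈ S := by
  have := Algebra.adjoin_le (Set.range_subset_iff.2 h)
  rw [adjoin_range_tgen] at this
  exact this trivial

/-- The elements whose left multiplication preserves `M` form a subalgebra containing the
generators. -/
theorem mem_of_tgen_mul_mem {q : ℂ} {M : Submodule ℂ (QTorus q)} (h1 : 1 ∈ M)
    (h : ∀ x, ∀ m ∈ M, tgen q x * m ∈ M) (a : QTorus q) : a ∈ M := by
  let S : Subalgebra ℂ (QTorus q) :=
    { carrier := {a | ∀ m ∈ M, a * m ∈ M}
      mul_mem' := fun {a b} ha hb m hm => by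
        rw [mul_assoc]
        exact ha _ (hb m hm)
      add_mem' := fun {a b} ha hb m hm => by
        rw [add_mul]
        exact add_mem (ha m hm) (hb m hm)
      algebraMap_mem' := fun c m hm => by
        rw [← Algebra.smul_def]
        exact M.smul_mem c hm }
  have := mem_of_tgen_mem (S := S) h a 1 h1
  rwa [mul_one] at this

theorem commute_of_inverse {R : Type*} [Monoid R] {a b c : R} (hab : a * b = 1) (hba : b * a = 1)
    (h : Commute c a) : Commute c b :=
  Commute.units_inv_right (u := Units.mk a b hab hba) h

theorem central_of_commute {q : ℂ} {c : QTorus q} (h1 : Commute c (tgen q .t1))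
    (h2 : Commute c (tgen q .t2)) (r : QTorus q) : c * r = r * c := by
  refine (Subalgebra.mem_centralizer_iff ℂ (s := {c})).1
    (mem_of_tgen_mem (S := Subalgebra.centralizer ℂ {c}) (fun x => ?_) r) c rfl
  rw [Subalgebra.mem_centralizer_iff]
  rintro _ rfl
  cases x with
  | t1 => exact h1
  | t2 => exact h2
  | t1inv => exact commute_of_inverse (tgen_mul_inv1 q) (tgen_inv_mul1 q) h1
  | t2inv => exact commute_of_inverse (tgen_mul_inv2 q) (tgen_inv_mul2 q) h2

variable (q θ₁ θ₂ : ℤˣ)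

theorem torusBar_tgen (x : TorusGen) :
    (torusBar q θ₁ θ₂).toLin (tgen (sgn q) x) = sgn (genSign θ₁ θ₂ x) • tgen (sgn q) x :=
  congrArg MulOpposite.unop (barHom_tgen q θ₁ θ₂ x)

theorem torusBar_tgen_mul_self (x : TorusGen) :
    (torusBar q θ₁ θ₂).toLin (tgen (sgn q) x * tgen (sgn q) x)
      = tgen (sgn q) x * tgen (sgn q) x := by
  rw [(torusBar q θ₁ θ₂).map_mul', torusBar_tgen, smul_mul_smul_comm, sgn_mul_self, one_smul]

theorem commute_mul_self_of_twist {R : Type*} [Ring R] [Algebra ℂ R] {a b : R}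
    (h : b * a = sgn q • (a * b)) : Commute (a * a) b ∧ Commute (b * b) a := by
  constructor
  · rw [Commute, SemiconjBy, ← mul_assoc, h, smul_mul_assoc, mul_assoc a b a, h, mul_smul_comm,
      smul_smul, sgn_mul_self, one_smul, mul_assoc]
  · rw [Commute, SemiconjBy, mul_assoc, h, mul_smul_comm, ← mul_assoc, h, smul_mul_assoc,
      smul_smul, sgn_mul_self, one_smul, mul_assoc]

theorem tgen_mul_self_mem_centralFixed (x : TorusGen) :
    tgen (sgn q) x * tgen (sgn q) x ∈ centralFixed (torusBar q θ₁ θ₂) := by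
  refine mem_centralFixed.2 ⟨?_, torusBar_tgen_mul_self q θ₁ θ₂ x⟩
  obtain ⟨h12, h21⟩ := commute_mul_self_of_twist q (tgen_twist (sgn q))
  have c1 := central_of_commute ((Commute.refl _).mul_left (Commute.refl _)) h12
  have c2 := central_of_commute h21 ((Commute.refl _).mul_left (Commute.refl _))
  have hsq {a b : QTorus (sgn q)} (hab : a * b = 1) : a * a * (b * b) = 1 := by
    rw [mul_assoc, ← mul_assoc a b, hab, one_mul, hab]
  cases x with
  | t1 => exact c1
  | t2 => exact c2
  | t1inv => exact fun r => (commute_of_inverse (hsq (tgen_mul_inv1 _)) (hsq (tgen_inv_mul1 _))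
      (show Commute r _ from (c1 r).symm)).symm
  | t2inv => exact fun r => (commute_of_inverse (hsq (tgen_mul_inv2 _)) (hsq (tgen_inv_mul2 _))
      (show Commute r _ from (c2 r).symm)).symm

theorem sgn_one : sgn 1 = 1 := by simp [sgn]

theorem sgn_neg_one : sgn (-1) = -1 := by simp [sgn]

theorem tgen_twist_of_sgn_neg_one :
    tgen (sgn (-1)) .t2 * tgen (sgn (-1)) .t1 = -(tgen (sgn (-1)) .t1 * tgen (sgn (-1)) .t2) :=
  (tgen_twist (sgn (-1))).trans ((congrArg (· • _) sgn_neg_one).trans (neg_one_smul ℂ _))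

theorem mul_comm_of_sgn_one (a b : QTorus (sgn 1)) : a * b = b * a := by
  have h : Commute (tgen (sgn 1) .t2) (tgen (sgn 1) .t1) := by
    exact (tgen_twist (sgn 1)).trans ((congrArg (· • _) sgn_one).trans (one_smul ℂ _))
  refine central_of_commute (Commute.symm ?_) (Commute.symm ?_) b
  · exact central_of_commute (Commute.refl _) h.symm a
  · exact central_of_commute h (Commute.refl _) a

/-- For `q = -1` the algebra `ℂ_q` is spanned by `1, t₁, t₂, t₁t₂` over its centre. -/
theorem exists_eq_of_sgn_neg_one (a : QTorus (sgn (-1))) :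
    ∃ w₀ ∈ centralFixed (torusBar (-1) θ₁ θ₂), ∃ w₁ ∈ centralFixed (torusBar (-1) θ₁ θ₂),
      ∃ w₂ ∈ centralFixed (torusBar (-1) θ₁ θ₂), ∃ w₃ ∈ centralFixed (torusBar (-1) θ₁ θ₂),
      a = w₀ + w₁ * tgen _ .t1 + w₂ * tgen _ .t2 + w₃ * (tgen _ .t1 * tgen _ .t2) := by
  set Z := centralFixed (torusBar (-1) θ₁ θ₂)
  set t₁ := tgen (sgn (-1)) .t1 with ht₁
  set t₂ := tgen (sgn (-1)) .t2 with ht₂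
  have hcomm : t₂ * t₁ = -(t₁ * t₂) := tgen_twist_of_sgn_neg_one
  let M : Submodule ℂ (QTorus (sgn (-1))) :=
    { carrier := {a | ∃ w₀ ∈ Z, ∃ w₁ ∈ Z, ∃ w₂ ∈ Z, ∃ w₃ ∈ Z,
        a = w₀ + w₁ * t₁ + w₂ * t₂ + w₃ * (t₁ * t₂)}
      zero_mem' := ⟨0, zero_mem _, 0, zero_mem _, 0, zero_mem _, 0, zero_mem _, by simp⟩
      add_mem' := by
        rintro _ _ ⟨w₀, h₀, w₁, h₁, w₂, h₂, w₃, h₃, rfl⟩ ⟨v₀, g₀, v₁, g₁, v₂, g₂, v₃, g₃, rfl⟩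
        refine ⟨_, add_mem h₀ g₀, _, add_mem h₁ g₁, _, add_mem h₂ g₂, _, add_mem h₃ g₃, ?_⟩
        simp only [add_mul]
        abel
      smul_mem' := by
        rintro c _ ⟨w₀, h₀, w₁, h₁, w₂, h₂, w₃, h₃, rfl⟩
        refine ⟨_, Z.smul_mem h₀ c, _, Z.smul_mem h₁ c, _, Z.smul_mem h₂ c, _, Z.smul_mem h₃ c, ?_⟩
        simp only [smul_add, smul_mul_assoc] }
  have hZ : ∀ z ∈ Z, ∀ m ∈ M, z * m ∈ M := by
    rintro z hz _ ⟨w₀, h₀, w₁, h₁, w₂, h₂, w₃, h₃, rfl⟩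
    refine ⟨_, mul_mem hz h₀, _, mul_mem hz h₁, _, mul_mem hz h₂, _, mul_mem hz h₃, ?_⟩
    simp only [mul_add, mul_assoc]
  have hs₁ : t₁ * t₁ ∈ Z := tgen_mul_self_mem_centralFixed _ _ _ _
  have hs₂ : t₂ * t₂ ∈ Z := tgen_mul_self_mem_centralFixed _ _ _ _
  have hM₁ : ∀ m ∈ M, t₁ * m ∈ M := by
    rintro _ ⟨w₀, h₀, w₁, h₁, w₂, h₂, w₃, h₃, rfl⟩
    refine ⟨_, mul_mem h₁ hs₁, _, h₀, _, mul_mem h₃ hs₁, _, h₂, ?_⟩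
    have e (w r : QTorus (sgn (-1))) (hw : w ∈ Z) : t₁ * (w * r) = w * (t₁ * r) := by
      rw [← mul_assoc, ← hw.1, mul_assoc]
    rw [mul_add, mul_add, mul_add, e _ _ h₁, e _ _ h₂, e _ _ h₃, ← h₀.1]
    simp only [mul_assoc]
    abel
  have hM₂ : ∀ m ∈ M, t₂ * m ∈ M := by
    rintro _ ⟨w₀, h₀, w₁, h₁, w₂, h₂, w₃, h₃, rfl⟩
    refine ⟨_, mul_mem h₂ hs₂, _, neg_mem (mul_mem h₃ hs₂), _, h₀, _, neg_mem h₁, ?_⟩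
    have e (w r : QTorus (sgn (-1))) (hw : w ∈ Z) : t₂ * (w * r) = w * (t₂ * r) := by
      rw [← mul_assoc, ← hw.1, mul_assoc]
    rw [mul_add, mul_add, mul_add, e _ _ h₁, e _ _ h₂, e _ _ h₃, ← h₀.1, ← mul_assoc t₂ t₁ t₂,
      hcomm, neg_mul, mul_neg, neg_mul, mul_assoc w₃, hs₂.1 t₁]
    simp only [mul_neg, neg_mul, mul_assoc]
    abel
  -- Inverse generators reduce to the others through `t⁻¹m = t⁻²(tm)`, with `t⁻²` central and fixed.
  have hinv {x y : TorusGen} (hxy : tgen (sgn (-1)) x * tgen (sgn (-1)) y = 1)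
      (hy : ∀ m ∈ M, tgen (sgn (-1)) y * m ∈ M) : ∀ m ∈ M, tgen (sgn (-1)) x * m ∈ M := by
    intro m hm
    have h := hZ _ (tgen_mul_self_mem_centralFixed (-1) θ₁ θ₂ x) _ (hy m hm)
    rwa [mul_assoc, ← mul_assoc _ _ m, hxy, one_mul] at h
  refine mem_of_tgen_mul_mem (M := M) ?_ (fun x => ?_) a
  · exact ⟨1, one_mem _, 0, zero_mem _, 0, zero_mem _, 0, zero_mem _, by simp⟩
  · cases x with
    | t1 => exact hM₁
    | t2 => exact hM₂
    | t1inv => exact hinv (tgen_inv_mul1 _) hM₁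
    | t2inv => exact hinv (tgen_inv_mul2 _) hM₂

/-- Conjugation by `t₁` splits off the terms containing `t₂`, then `t₂` splits off `w₁t₁`. Both
parts lie in `[J,R]`, leaving `w₀ ∈ J₊`. -/
theorem idealSub_le_of_sgn_neg_one (J : TwoSidedIdeal (QTorus (sgn (-1)))) :
    idealSub ℂ J ≤ (symm (torusBar (-1) θ₁ θ₂) ⊓ idealSub ℂ J) ⊔ comm (idealSub ℂ J) ⊤ := by
  intro a ha
  replace ha : a ∈ J := ha
  obtain ⟨w₀, h₀, w₁, h₁, w₂, h₂, w₃, h₃, rfl⟩ := exists_eq_of_sgn_neg_one θ₁ θ₂ a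
  set t₁ := tgen (sgn (-1)) .t1
  set t₂ := tgen (sgn (-1)) .t2
  have hcomm : t₂ * t₁ = -(t₁ * t₂) := tgen_twist_of_sgn_neg_one
  have e {t w : QTorus (sgn (-1))} (r : QTorus (sgn (-1)))
      (hw : w ∈ centralFixed (torusBar (-1) θ₁ θ₂)) : t * (w * r) = w * (t * r) := by
    rw [← mul_assoc, ← hw.1, mul_assoc]
  rw [add_assoc] at ha ⊢
  obtain ⟨hb, hc⟩ := mem_and_mem_comm_of_anticommute (k := ℂ) (tgen_mul_inv1 _) (tgen_inv_mul1 _)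
    (show t₁ * (w₀ + w₁ * t₁) = _ by
      rw [mul_add, add_mul, e _ h₁, ← h₀.1, mul_assoc])
    (show t₁ * (w₂ * t₂ + w₃ * (t₁ * t₂)) = _ by
      rw [mul_add, add_mul, e _ h₂, e _ h₃, mul_assoc, mul_assoc, mul_assoc t₁ t₂ t₁, hcomm]
      simp only [mul_neg, neg_add, neg_neg]) ha
  obtain ⟨h, hd⟩ := mem_and_mem_comm_of_anticommute (k := ℂ) (tgen_mul_inv2 _) (tgen_inv_mul2 _)
    (show t₂ * w₀ = _ from (h₀.1 _).symm)
    (show t₂ * (w₁ * t₁) = _ by rw [e _ h₁, hcomm, mul_neg, mul_assoc]) hb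
  exact add_mem (Submodule.add_mem_sup ⟨mem_symm.2 h₀.2, h⟩ hd) (Submodule.mem_sup_right hc)

theorem overG_eq_underG_torus {n : ℕ} [NeZero n] (ρ : ℤˣ) (J : TwoSidedIdeal (QTorus (sgn q))) :
    overG n ρ (torusBar q θ₁ θ₂) J = underG n ρ (torusBar q θ₁ θ₂) J := by
  rcases Int.units_eq_one_or q with rfl | rfl
  · exact overG_eq_underG_of_commute mul_comm_of_sgn_one
  · exact overG_eq_underG_of_le (idealSub_le_of_sgn_neg_one θ₁ θ₂ J)

end Torus

end BCGraded

end

open BCGraded in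
theorem theorem4p1 (n : ℕ) [NeZero n] (hn : 3 ≤ n) (ρ q θ₁ θ₂ : ℤˣ)
    (hP : (q, θ₁, θ₂) ∈ BCGraded.paramSet)
    (𝒥 : LieIdeal ℂ (BCGraded.gLie n ρ (BCGraded.torusBar q θ₁ θ₂)))
    (hfin : FiniteDimensional ℂ (BCGraded.gLie n ρ (BCGraded.torusBar q θ₁ θ₂) ⧸ 𝒥))
    (hss : LieAlgebra.HasTrivialRadical ℂ
      (BCGraded.gLie n ρ (BCGraded.torusBar q θ₁ θ₂) ⧸ 𝒥)) :
    ∃ f g : Polynomial ℂ,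
      f.eval 0 * g.eval 0 ≠ 0 ∧
      0 < f.natDegree * g.natDegree ∧
      IsCoprime f (Polynomial.derivative f) ∧
      IsCoprime g (Polynomial.derivative g) ∧
      f.comp (Polynomial.C (BCGraded.sgn θ₁ ^ orderOf q) * Polynomial.X) = f ∧
      g.comp (Polynomial.C (BCGraded.sgn θ₂ ^ orderOf q) * Polynomial.X) = g ∧
      BCGraded.IsInvolutive (BCGraded.torusBar q θ₁ θ₂) (BCGraded.idealJ q f g) ∧
      ∃ I : LieIdeal ℂ (BCGraded.gLie n ρ (BCGraded.torusBar q θ₁ θ₂)),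
        I.toSubmodule.map
            (BCGraded.gLie n ρ (BCGraded.torusBar q θ₁ θ₂)).toSubmodule.subtype
          = BCGraded.overG n ρ (BCGraded.torusBar q θ₁ θ₂) (BCGraded.idealJ q f g) ∧
        I ≤ 𝒥 ∧
        BCGraded.overG n ρ (BCGraded.torusBar q θ₁ θ₂) (BCGraded.idealJ q f g)
          = BCGraded.underG n ρ (BCGraded.torusBar q θ₁ θ₂) (BCGraded.idealJ q f g) := by
  -- Squares serve for both values of `q`: for `q = 1` the generator is central, but the involution
  -- may change its sign.
  have hz (x : TorusGen) : tgen (sgn q) x ^ 2 ∈ centralFixed (torusBar q θ₁ θ₂) :=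
    (sq (tgen (sgn q) x)).symm ▸ tgen_mul_self_mem_centralFixed q θ₁ θ₂ x
  have hsq {a b : QTorus (sgn q)} (hab : a * b = 1) : a ^ 2 * b ^ 2 = 1 := by
    rw [sq, sq, mul_assoc, ← mul_assoc a b, hab, one_mul, hab]
  obtain ⟨f₀, hf0, hfdeg, hfsep, hfJ⟩ := exists_separable_aeval_mem_coeffIdeal hn hfin hss
    (hz .t1) (hsq (tgen_inv_mul1 _))
  obtain ⟨g₀, hg0, hgdeg, hgsep, hgJ⟩ := exists_separable_aeval_mem_coeffIdeal hn hfin hss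
    (hz .t2) (hsq (tgen_inv_mul2 _))
  obtain ⟨f, hf0, hfdeg, hfsep, hfc, hf⟩ :=
    Polynomial.exists_aeval_pow_orderOf_eq q (sgn_mul_self θ₁) hf0 hfdeg hfsep
  obtain ⟨g, hg0, hgdeg, hgsep, hgc, hg⟩ :=
    Polynomial.exists_aeval_pow_orderOf_eq q (sgn_mul_self θ₂) hg0 hgdeg hgsep
  have hinv : IsInvolutive (torusBar q θ₁ θ₂) (idealJ q f g) := by
    refine isInvolutive_span ?_
    rintro a (rfl | rfl)
    · rw [hf, (aeval_mem_centralFixed (hz .t1) f₀).2]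
      exact .inl rfl
    · rw [hg, (aeval_mem_centralFixed (hz .t2) g₀).2]
      exact .inr rfl
  have hle : idealJ q f g ≤ coeffIdeal hn (lie_mem_ambient 𝒥) := by
    refine TwoSidedIdeal.span_le.2 ?_
    rintro a (rfl | rfl)
    · rwa [hf]
    · rwa [hg]
  have heq := overG_eq_underG_torus (n := n) q θ₁ θ₂ ρ (idealJ q f g)
  exact ⟨f, g, mul_ne_zero hf0 hg0, Nat.mul_pos hfdeg hgdeg, hfsep, hgsep, hfc, hgc, hinv,
    underLieIdeal n ρ hinv, (map_underLieIdeal hn hinv).trans heq.symm,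
    underLieIdeal_le hn hinv hle, heq⟩
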